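/- Let $V$ be a real vector space of dimension $n$, let $\Phi_V=(\phi_1,\dots,\phi_l)\in\bigoplus_{i=1}^l\wedge^{p_i}V^*$, and let $\mathcal O$ be its $GL(V)$-orbit. Let $X$ be a compact smooth $n$-manifold and let $\Phi^0=(\phi^0_1,\dots,\phi^0_l)$ be a smooth tuple of closed differential forms on $X$ such that for every $x\in X$ some (equivalently, every) linear isomorphism $T_xX\cong V$ carries $\Phi^0(x)$ into $\mathcal O$. Let $\Gamma(E^2)$ be the space of smooth tuples $\Psi\in\Gamma(\bigoplus_i\wedge^{p_i+1}T^*X)$ such that, for all $x$, $\Psi(x)$ lies in the span $E^2(T_xX)$ of the elements $\alpha\wedge i_v\Phi^0(x)=(\alpha\wedge i_v\phi^0_i(x))_i$ with $\alpha\in\wedge^2T_x^*X$, $v\in T_xX$. For $a\in\mathrm{End}(TX)$ (a smooth field of endomorphisms) let $\hat\rho_a$ act on forms by $(\hat\rho_a\eta)(u_1,\dots,u_p)=\sum_i\eta(u_1,\dots,au_i,\dots,u_p)$; it is the differential of $\rho_g\eta=\eta(g\,\cdot,\dots,g\,\cdot)$. Put $L_a=[\hat\rho_a,d]$, and let $N(a,b)\in\wedge^2\otimes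 TX$ be the tensor $$N(a,b)(u,v)=ab[u,v]+ba[u,v]+[au,bv]-[av,bu]-a[bu,v]+a[bv,u]-b[au,v]+b[av,u].$$ For $N\in\wedge^2\otimes TX$ let $i_N$ be the operator on forms which is linear in $N$ and equals $\alpha\wedge i_v$ for $N=\alpha\otimes v$. All these notions are extended to formal power series in $t$ coefficientwise; $(\cdot)_k$ denotes the coefficient of $t^k$. For $a=a(t)\in\mathrm{End}(TX)[[t]]$ put $G(a,a)=i_{N(a,a)}-L_{a^2}$ and $\mathrm{Ad}_{\hat\rho_a}P=[\hat\rho_a,P]$. Let $a_1,a_2,\dots\in\mathrm{End}(TX)$, $a=a(t)=\sum_{j\ge1}\frac1{j!}a_jt^j$ and $a_{<k}=\sum_{1\le j<k}\frac1{j!}a_jt^j$. Let $R_k=(\rho_{\exp a(t)}\Phi^0)_k$ and $$Ob_k(a_{<k})=\sum_{m=2}^k\frac1{m!}\,d\,(\hat\rho_{a_{<k}}^m)_k\,\Phi^0 .$$ Let $k\ge1$ and suppose that $dR_j=0$ for all $1\le j<k$. Then $$dR_k=\frac1{k!}\,d\hat\rho_{a_k}\Phi^0+Ob_k(a_{<k}),$$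 $$Ob_k(a_{<k})=\sum_{m=2}^k\frac{(-1)^{m-1}}{m!}\bigl(\mathrm{Ad}_{\hat\rho_a}^{m-2}G(a,a)\bigr)_k\Phi^0=\bigl(f(\mathrm{Ad}_{\hat\rho_a})G(a,a)\bigr)_k\Phi^0,$$ where $f(x)=-\frac1{2!}+\frac1{3!}x-\frac1{4!}x^2+\cdots=-\frac{e^{-x}-1+x}{x^2}$, and the last expression does not change if $a$ is replaced by $a_{<k}$. Moreover $Ob_k(a_{<k})\in\Gamma(E^2)$, and $Ob_k(a_{<k})$ is $d$-exact, i.e. $Ob_k(a_{<k})=d\beta$ for a smooth tuple $\beta\in\Gamma(\bigoplus_i\wedge^{p_i}T^*X)$. -/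

import Mathlib

open scoped Manifold ContDiff Bundle
noncomputable section
namespace GaugeDef

section LinearAlgebra
variable {E : Type*} [NormedAddCommGroup E] [NormedSpace ℝ E]

/-- The differential `ρ̂_ξ` of the action `ρ_g φ = φ(g ·, …, g ·)` of `GL(E)` on `⋀^p E*`:
the derivative of `g ↦ ρ_g φ` at the identity in the direction `ξ`. -/
def infAction (ξ : E →L[ℝ] E) {p : ℕ} (φ : E [⋀^Fin p]→L[ℝ] ℝ) : E [⋀^Fin p]→L[ℝ] ℝ :=
  φ.fderivCompContinuousLinearMap (ContinuousLinearMap.id ℝ E) ξ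

theorem infAction_apply (ξ : E →L[ℝ] E) {p : ℕ} (φ : E [⋀^Fin p]→L[ℝ] ℝ) (u : Fin p → E) :
    infAction ξ φ u = ∑ i, φ (Function.update u i (ξ (u i))) := by
  rw [infAction, ContinuousAlternatingMap.fderivCompContinuousLinearMap_apply]
  refine Finset.sum_congr rfl fun i _ => congrArg φ (funext fun j => ?_)
  by_cases h : j = i
  · subst h; simp
  · simp [Function.update_of_ne h]

/-- The coefficient of `t^k` in `ρ_{g(t)} φ = φ(g(t) ·, …, g(t) ·)`, where `g(t) = ∑ g_j t^j`:
the value on `(u_1, …, u_p)` is the sum of `φ(g_{c_1} u_1, …, g_{c_p} u_p)` over all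
`c_1 + ⋯ + c_p = k`. -/
def pullbackCoeff (g : ℕ → E →L[ℝ] E) (k : ℕ) {p : ℕ} (φ : E [⋀^Fin p]→L[ℝ] ℝ) :
    E [⋀^Fin p]→L[ℝ] ℝ where
  toContinuousMultilinearMap := ∑ c ∈ Finset.piAntidiag Finset.univ k,
    φ.toContinuousMultilinearMap.compContinuousLinearMap fun i => g (c i)
  map_eq_zero_of_eq' := by
    intro v i j hv hij
    change (∑ c ∈ Finset.piAntidiag Finset.univ k,
      φ.toContinuousMultilinearMap.compContinuousLinearMap fun i => g (c i)) v = 0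
    rw [_root_.sum_apply]
    refine Finset.sum_involution (fun c _ => c ∘ Equiv.swap i j) ?_ ?_ ?_ ?_
    · intro c _
      have h : (fun l => g ((c ∘ Equiv.swap i j) l) (v l))
          = (fun l => g (c l) (v l)) ∘ Equiv.swap i j := by
        funext l
        have : v (Equiv.swap i j l) = v l := by
          rcases eq_or_ne l i with rfl | hi
          · simp [hv]
          · rcases eq_or_ne l j with rfl | hj
            · simp [hv]
            · rw [Equiv.swap_apply_of_ne_of_ne hi hj]
        simp [this]
      change φ (fun l => g (c l) (v l)) + φ (fun l => g ((c ∘ Equiv.swap i j) l) (v l)) = 0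
      rw [h]
      exact φ.toAlternatingMap.map_add_swap _ hij
    · intro c _ hne heq
      apply hne
      have hc : c i = c j := by
        have := congrFun heq i
        simpa using this.symm
      exact φ.map_eq_zero_of_eq (fun l => g (c l) (v l)) (by simp [hc, hv]) hij
    · intro c hc
      rw [Finset.mem_piAntidiag] at hc ⊢
      refine ⟨?_, fun _ _ => Finset.mem_univ _⟩
      rw [← hc.1]
      exact Equiv.sum_comp (Equiv.swap i j) c
    · intro c _
      funext l
      simp

theorem pullbackCoeff_apply (g : ℕ → E →L[ℝ] E) (k : ℕ) {p : ℕ} (φ : E [⋀^Fin p]→L[ℝ] ℝ)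
    (u : Fin p → E) : pullbackCoeff g k φ u =
      ∑ c ∈ Finset.piAntidiag Finset.univ k, φ fun i => g (c i) (u i) := by
  change (∑ c ∈ Finset.piAntidiag Finset.univ k,
      φ.toContinuousMultilinearMap.compContinuousLinearMap fun i => g (c i)) u = _
  rw [_root_.sum_apply]
  rfl

/-- For skew-symmetric `B`, the alternating form
`(u_0, …, u_{q+1}) ↦ ∑_{i<j} (-1)^{i+j+1} B(u_i, u_j)(u_0, …, û_i, …, û_j, …, u_{q+1})`,
see `altTwo_apply` (where the pair `i < j` is written `(i.castSucc, j.succ)`). -/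
def altTwo {q : ℕ} (B : E →L[ℝ] E →L[ℝ] E [⋀^Fin q]→L[ℝ] ℝ) : E [⋀^Fin (q + 2)]→L[ℝ] ℝ :=
  (1 / 2 : ℝ) • ContinuousAlternatingMap.alternatizeUncurryFin
    (ContinuousAlternatingMap.alternatizeUncurryFinCLM ℝ E ℝ ∘L B)

theorem altTwo_apply {q : ℕ} (B : E →L[ℝ] E →L[ℝ] E [⋀^Fin q]→L[ℝ] ℝ)
    (hB : ∀ u w, B u w = - B w u) (u : Fin (q + 2) → E) :
    altTwo B u = ∑ i : Fin (q + 1), ∑ j ≥ i, (-1 : ℝ) ^ (i + j : ℕ) *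
      B (u i.castSucc) (u j.succ) (j.removeNth (i.castSucc.removeNth u)) := by
  rw [altTwo, ContinuousAlternatingMap.smul_apply,
    ContinuousAlternatingMap.alternatizeUncurryFin_alternatizeUncurryFinCLM_comp_apply,
    Finset.smul_sum]
  refine Finset.sum_congr rfl fun i _ => ?_
  rw [Finset.smul_sum]
  refine Finset.sum_congr rfl fun j _ => ?_
  rw [hB (u j.succ) (u i.castSucc)]
  simp
  ring

/-- `α ∧ i_v φ` for a two-form `α`, a vector `v` and a `p`-form `φ` (with `i_v φ = 0` if `p = 0`). -/
def wedgeInterior (α : E →L[ℝ] E →L[ℝ] ℝ) (v : E) :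
    {p : ℕ} → E [⋀^Fin p]→L[ℝ] ℝ → E [⋀^Fin (p + 1)]→L[ℝ] ℝ
  | 0, _ => 0
  | _ + 1, φ => altTwo ((ContinuousLinearMap.toSpanSingleton ℝ (φ.curryLeft v)).postcomp E ∘L α)

/-- `i_N φ` for `N ∈ ⋀² ⊗ T`, i.e. the composition of interior product and wedge product:
for `N = α ⊗ v` it is `α ∧ i_v φ`. -/
def insertTwoForm (N : E →L[ℝ] E →L[ℝ] E) :
    {p : ℕ} → E [⋀^Fin p]→L[ℝ] ℝ → E [⋀^Fin (p + 1)]→L[ℝ] ℝ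
  | 0, _ => 0
  | _ + 1, φ => altTwo (φ.curryLeft.postcomp E ∘L N)

theorem wedgeInterior_apply (α : E →L[ℝ] E →L[ℝ] ℝ) (hα : ∀ u, α u u = 0) (v : E) {q : ℕ}
    (φ : E [⋀^Fin (q + 1)]→L[ℝ] ℝ) (u : Fin (q + 2) → E) :
    wedgeInterior α v φ u = ∑ i : Fin (q + 1), ∑ j ≥ i, (-1 : ℝ) ^ (i + j : ℕ) *
      (α (u i.castSucc) (u j.succ) *
        φ (Matrix.vecCons v (j.removeNth (i.castSucc.removeNth u)))) := by
  have h : ∀ u w, α u w = - α w u := fun u w => by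
    have := hα (u + w)
    simp [hα] at this
    linarith
  rw [wedgeInterior, altTwo_apply]
  · simp
  · intro u w
    ext
    simp [h u w]

theorem insertTwoForm_apply (N : E →L[ℝ] E →L[ℝ] E) (hN : ∀ u, N u u = 0) {q : ℕ}
    (φ : E [⋀^Fin (q + 1)]→L[ℝ] ℝ) (u : Fin (q + 2) → E) :
    insertTwoForm N φ u = ∑ i : Fin (q + 1), ∑ j ≥ i, (-1 : ℝ) ^ (i + j : ℕ) *
      φ (Matrix.vecCons (N (u i.castSucc) (u j.succ))
        (j.removeNth (i.castSucc.removeNth u))) := by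
  have h : ∀ u w, N u w = - N w u := fun u w => by
    have := hN (u + w)
    simp [hN] at this
    exact eq_neg_of_add_eq_zero_left this
  rw [insertTwoForm, altTwo_apply]
  · simp
  · intro u w
    simp [h u w]

/-- The space `E²` spanned by all `α ∧ i_v Φ = (α ∧ i_v φ_1, …, α ∧ i_v φ_l)` with `α` a two-form
and `v` a vector. -/
def E2 {l : ℕ} {p : Fin l → ℕ} (Φ : ∀ i, E [⋀^Fin (p i)]→L[ℝ] ℝ) :
    Submodule ℝ (∀ i, E [⋀^Fin (p i + 1)]→L[ℝ] ℝ) :=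
  Submodule.span ℝ {ψ | ∃ α : E →L[ℝ] E →L[ℝ] ℝ, (∀ u, α u u = 0) ∧
    ∃ v : E, ψ = fun i => wedgeInterior α v (Φ i)}

/-- The `GL(E)`-orbit of `Φ = (φ_1, …, φ_l)`. -/
def glOrbit {l : ℕ} {p : Fin l → ℕ} (Φ : ∀ i, E [⋀^Fin (p i)]→L[ℝ] ℝ) :
    Set (∀ i, E [⋀^Fin (p i)]→L[ℝ] ℝ) :=
  {Ψ | ∃ g : E ≃L[ℝ] E, Ψ = fun i => (Φ i).compContinuousLinearMap (g : E →L[ℝ] E)}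

end LinearAlgebra

section Manifold

/-- The model space `ℝⁿ`. -/
abbrev Model (n : ℕ) : Type := EuclideanSpace ℝ (Fin n)

variable {n : ℕ} {X : Type*} [TopologicalSpace X] [ChartedSpace (Model n) X]

/-- Not necessarily smooth `p`-forms on `X`; the tangent space of `X` at each of its points is, by
definition in Mathlib, the model space. -/
abbrev FormField (n : ℕ) (X : Type*) [TopologicalSpace X] [ChartedSpace (Model n) X] (p : ℕ) :
    Type _ :=
  ∀ _x : X, Model n [⋀^Fin p]→L[ℝ] ℝ

/-- The derivative at `y` of the inverse of the preferred chart at `x₀`. -/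
def chartInvDeriv (x₀ : X) (y : Model n) : Model n →L[ℝ] Model n :=
  mfderiv 𝓘(ℝ, Model n) (𝓡 n) (extChartAt (𝓡 n) x₀).symm y

/-- The derivative at `x` of the preferred chart at `x`. -/
def chartDeriv (x : X) : Model n →L[ℝ] Model n :=
  mfderiv (𝓡 n) 𝓘(ℝ, Model n) (extChartAt (𝓡 n) x) x

/-- The form `η` in the preferred chart at `x₀`, i.e. its pull-back by the inverse of that chart. -/
def chartForm {p : ℕ} (η : FormField n X p) (x₀ : X) (y : Model n) : Model n [⋀^Fin p]→L[ℝ] ℝ :=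
  (η ((extChartAt (𝓡 n) x₀).symm y)).compContinuousLinearMap
    (chartInvDeriv x₀ y)

/-- Smoothness of a form: smoothness in charts. -/
def IsSmoothForm {p : ℕ} (η : FormField n X p) : Prop :=
  ∀ x₀ : X, ContDiffOn ℝ ∞ (chartForm η x₀) (extChartAt (𝓡 n) x₀).target

/-- The exterior derivative of a form on `X`, computed at `x` in the preferred chart at `x`. -/
def extD {p : ℕ} (η : FormField n X p) : FormField n X (p + 1) := fun x =>
  (extDeriv (chartForm η x) (extChartAt (𝓡 n) x x)).compContinuousLinearMap
    (chartDeriv x)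

variable [IsManifold (𝓡 n) ∞ X]

/-- `End(TX)`: the smooth fields of endomorphisms of the tangent bundle. -/
abbrev EndField (n : ℕ) (X : Type*) [TopologicalSpace X] [ChartedSpace (Model n) X]
    [IsManifold (𝓡 n) ∞ X] : Type _ :=
  Cₛ^∞⟮𝓡 n; Model n →L[ℝ] Model n,
    fun x : X => TangentSpace (𝓡 n) x →L[ℝ] TangentSpace (𝓡 n) x⟯

/-- The value at `x`, as an endomorphism of the model space. -/
def EndField.val (a : EndField n X) (x : X) : Model n →L[ℝ] Model n := a x

/-- The identity field. -/
def EndField.one : EndField n X where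
  toFun x := ContinuousLinearMap.id ℝ (TangentSpace (𝓡 n) x)
  contMDiff_toFun := by
    intro x₀
    rw [contMDiffAt_hom_bundle]
    refine ⟨contMDiffAt_id, ?_⟩
    refine (contMDiffAt_const (c := ContinuousLinearMap.id ℝ (Model n))).congr_of_eventuallyEq ?_
    filter_upwards [(trivializationAt (Model n) (TangentSpace (𝓡 n)) x₀).open_baseSet.mem_nhds
      (FiberBundle.mem_baseSet_trivializationAt' x₀)] with x hx
    ext v : 1
    simp [ContinuousLinearMap.inCoordinates_eq hx hx]

/-- Pointwise composition. -/
def EndField.mul (a b : EndField n X) : EndField n X where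
  toFun x := (a x).comp (b x)
  contMDiff_toFun := by
    intro x₀
    have ha := (contMDiffAt_hom_bundle _).1 (a.contMDiff x₀)
    have hb := (contMDiffAt_hom_bundle _).1 (b.contMDiff x₀)
    rw [contMDiffAt_hom_bundle]
    refine ⟨contMDiffAt_id, ?_⟩
    refine (ha.2.clm_comp hb.2).congr_of_eventuallyEq ?_
    filter_upwards [(trivializationAt (Model n) (TangentSpace (𝓡 n)) x₀).open_baseSet.mem_nhds
      (FiberBundle.mem_baseSet_trivializationAt' x₀)] with x hx
    simp only [ContinuousLinearMap.inCoordinates_eq hx hx]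
    ext v : 1
    simp only [ContinuousLinearMap.coe_comp, Function.comp_apply, ContinuousLinearEquiv.coe_coe,
      ContinuousLinearEquiv.symm_apply_apply]

instance : One (EndField n X) := ⟨EndField.one⟩
instance : Mul (EndField n X) := ⟨EndField.mul⟩

theorem EndField.one_apply (x : X) :
    (1 : EndField n X) x = ContinuousLinearMap.id ℝ (TangentSpace (𝓡 n) x) := rfl

theorem EndField.mul_apply (a b : EndField n X) (x : X) : (a * b) x = (a x).comp (b x) := rfl

instance : Ring (EndField n X) :=
  { (inferInstance : AddCommGroup (EndField n X)), (inferInstance : Mul (EndField n X)),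
    (inferInstance : One (EndField n X)) with
    left_distrib := fun a b c => by
      ext x v
      simp [EndField.mul_apply]
    right_distrib := fun a b c => by
      ext x v
      simp [EndField.mul_apply]
    zero_mul := fun a => by
      ext x v
      simp [EndField.mul_apply]
    mul_zero := fun a => by
      ext x v
      simp [EndField.mul_apply]
    mul_assoc := fun _ _ _ => rfl
    one_mul := fun _ => rfl
    mul_one := fun _ => rfl }

/-- The vector field `N(a,b)(U,V) = ab[U,V] + ba[U,V] + [aU,bV] - [aV,bU]
- a[bU,V] + a[bV,U] - b[aU,V] + b[aV,U]`. -/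
def nijenhuisField (a b : EndField n X) (U V : Π x : X, TangentSpace (𝓡 n) x) :
    Π x : X, TangentSpace (𝓡 n) x :=
  letI A : (Π x : X, TangentSpace (𝓡 n) x) → Π x : X, TangentSpace (𝓡 n) x :=
    fun W x => a x (W x)
  letI B : (Π x : X, TangentSpace (𝓡 n) x) → Π x : X, TangentSpace (𝓡 n) x :=
    fun W x => b x (W x)
  letI br := VectorField.mlieBracket (𝓡 n) (M := X)
  A (B (br U V)) + B (A (br U V)) + br (A U) (B V) - br (A V) (B U)
    - A (br (B U) V) + A (br (B V) U) - B (br (A U) V) + B (br (A V) U)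

/-- Differentiability of a vector field at a point. -/
abbrev DiffVFAt (U : Π x : X, TangentSpace (𝓡 n) x) (x : X) : Prop :=
  MDifferentiableAt (𝓡 n) ((𝓡 n).prod 𝓘(ℝ, Model n))
    (fun y => Bundle.TotalSpace.mk' (Model n) y (U y)) x

theorem EndField.mdiffAt_apply (a : EndField n X) {U : Π x : X, TangentSpace (𝓡 n) x} {x : X}
    (hU : DiffVFAt U x) : DiffVFAt (fun y => a y (U y)) x :=
  ((a.contMDiff x).mdifferentiableAt (by simp)).clm_bundle_apply hU

theorem nijenhuisField_swap (a b : EndField n X) (U V : Π x : X, TangentSpace (𝓡 n) x) :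
    nijenhuisField a b U V = - nijenhuisField a b V U := by
  funext x
  simp only [nijenhuisField, Pi.add_apply, Pi.sub_apply, Pi.neg_apply]
  rw [VectorField.mlieBracket_swap_apply (V := U) (W := V)]
  simp only [map_neg]
  module

theorem nijenhuisField_tensorial (a b : EndField n X) (x : X)
    (V : Π x : X, TangentSpace (𝓡 n) x) (_hV : DiffVFAt V x) :
    TensorialAt (𝓡 n) (Model n) (fun U => nijenhuisField a b U V x) x where
  smul {f U} hf hU := by
    have e (c : EndField n X) : (fun y => c y ((f • U) y)) = f • (fun y => c y (U y)) := by
      funext y; simp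
    have ha := a.mdiffAt_apply hU
    have hb := b.mdiffAt_apply hU
    simp only [nijenhuisField, Pi.add_apply, Pi.sub_apply, e,
      VectorField.mlieBracket_smul_left hf hU, VectorField.mlieBracket_smul_left hf ha,
      VectorField.mlieBracket_smul_left hf hb, VectorField.mlieBracket_smul_right hf hU,
      VectorField.mlieBracket_smul_right hf hb, map_add, map_smul]
    module
  add {U U'} hU hU' := by
    have e (c : EndField n X) :
        (fun y => c y ((U + U') y)) = (fun y => c y (U y)) + (fun y => c y (U' y)) := by
      funext y
      exact map_add (c y) (U y) (U' y)
    have ha := a.mdiffAt_apply hU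
    have hb := b.mdiffAt_apply hU
    have ha' := a.mdiffAt_apply hU'
    have hb' := b.mdiffAt_apply hU'
    simp only [nijenhuisField, e]
    simp only [Pi.add_apply, Pi.sub_apply,
      VectorField.mlieBracket_add_left hU hU', VectorField.mlieBracket_add_left ha ha',
      VectorField.mlieBracket_add_left hb hb', VectorField.mlieBracket_add_right hU hU',
      VectorField.mlieBracket_add_right hb hb', map_add]
    module

theorem nijenhuisField_tensorial' (a b : EndField n X) (x : X)
    (U : Π x : X, TangentSpace (𝓡 n) x) (hU : DiffVFAt U x) :
    TensorialAt (𝓡 n) (Model n) (fun V => nijenhuisField a b U V x) x where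
  smul {f V} hf hV := by
    rw [nijenhuisField_swap a b U, nijenhuisField_swap a b U, Pi.neg_apply, Pi.neg_apply,
      (nijenhuisField_tensorial a b x U hU).smul hf hV, smul_neg]
  add {V V'} hV hV' := by
    rw [nijenhuisField_swap a b U, nijenhuisField_swap a b U V, nijenhuisField_swap a b U V',
      Pi.neg_apply, Pi.neg_apply, Pi.neg_apply,
      (nijenhuisField_tensorial a b x U hU).add hV hV', neg_add]

/-- The tensor `N(a,b) ∈ ⋀² ⊗ T`; `nijenhuis_apply` computes it on vector fields. -/
def nijenhuis (a b : EndField n X) (x : X) :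
    TangentSpace (𝓡 n) x →L[ℝ] TangentSpace (𝓡 n) x →L[ℝ] TangentSpace (𝓡 n) x :=
  TensorialAt.mkHom₂ (fun U V => nijenhuisField a b U V x) x
    (nijenhuisField_tensorial a b x) (nijenhuisField_tensorial' a b x)

theorem nijenhuis_apply (a b : EndField n X) {x : X} {U V : Π x : X, TangentSpace (𝓡 n) x}
    (hU : DiffVFAt U x) (hV : DiffVFAt V x) :
    nijenhuis a b x (U x) (V x) = nijenhuisField a b U V x :=
  TensorialAt.mkHom₂_apply _ _ hU hV

/-- The value of `N(a,b)` at `x`, as a bilinear map on the model space. -/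
def nijenhuisVal (a b : EndField n X) (x : X) : Model n →L[ℝ] Model n →L[ℝ] Model n :=
  nijenhuis a b x

/-- `ρ̂_b η`. -/
def rhoHat (b : EndField n X) {p : ℕ} (η : FormField n X p) : FormField n X p :=
  fun x => infAction (b.val x) (η x)

/-- `L_b = [ρ̂_b, d]`. -/
def lieOp (b : EndField n X) {p : ℕ} (η : FormField n X p) : FormField n X (p + 1) :=
  rhoHat b (extD η) - extD (rhoHat b η)

/-- `i_{N(a,b)} η`. -/
def insertNijenhuis (a b : EndField n X) {p : ℕ} (η : FormField n X p) : FormField n X (p + 1) :=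
  fun x => insertTwoForm (nijenhuisVal a b x) (η x)

/-- Formal power series `∑ P_k t^k` of operators from `p`-forms to `q`-forms. -/
abbrev OpSeries (n : ℕ) (X : Type*) [TopologicalSpace X] [ChartedSpace (Model n) X] (p q : ℕ) :
    Type _ :=
  ℕ → FormField n X p → FormField n X q

/-- `a(t) = ∑_{k ≥ 1} (1/k!) a_k t^k ∈ End(TX)[[t]]` (the entry `a 0` is ignored). -/
def gaugeSeries (a : ℕ → EndField n X) : PowerSeries (EndField n X) :=
  PowerSeries.mk fun k => if k = 0 then 0 else (k.factorial : ℝ)⁻¹ • a k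

/-- `a_{<k}(t) = ∑_{1 ≤ j < k} (1/j!) a_j t^j`. -/
def gaugeSeriesLT (a : ℕ → EndField n X) (k : ℕ) : PowerSeries (EndField n X) :=
  gaugeSeries fun j => if j < k then a j else 0

/-- `exp A(t) = ∑_l (1/l!) A(t)^l` for a series `A(t)` without constant term; only the terms with
`l ≤ k` contribute to the coefficient of `t^k`. -/
def expSeries (A : PowerSeries (EndField n X)) : PowerSeries (EndField n X) :=
  PowerSeries.mk fun k => ∑ l ∈ Finset.range (k + 1),
    (l.factorial : ℝ)⁻¹ • PowerSeries.coeff k (A ^ l)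

/-- The coefficient of `t^k` in `ρ_{g(t)} η`. -/
def gaugeAction (g : PowerSeries (EndField n X)) {p : ℕ} : OpSeries n X p p := fun k η x =>
  pullbackCoeff (fun j => EndField.val (PowerSeries.coeff j g) x) k (η x)

/-- `ρ̂_{A(t)}^l` as a power series of operators. -/
def rhoHatPow (A : PowerSeries (EndField n X)) {p : ℕ} : ℕ → OpSeries n X p p
  | 0 => fun k η => if k = 0 then η else 0
  | l + 1 => fun k η => ∑ ij ∈ Finset.HasAntidiagonal.antidiagonal k,
      rhoHat (PowerSeries.coeff ij.1 A) (rhoHatPow A l ij.2 η)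

/-- `Ob_k(A) = ∑_{l=2}^k (1/l!) (d ρ̂_A^l)_k`. -/
def obstruction (A : PowerSeries (EndField n X)) {p : ℕ} : OpSeries n X p (p + 1) := fun k η =>
  ∑ l ∈ Finset.Icc 2 k, (l.factorial : ℝ)⁻¹ • extD (rhoHatPow A l k η)

/-- `G(A,A) = i_{N(A,A)} - L_{A²}` as a power series of operators. -/
def GSeries (A : PowerSeries (EndField n X)) {p : ℕ} : OpSeries n X p (p + 1) := fun k η =>
  (∑ ij ∈ Finset.HasAntidiagonal.antidiagonal k,
    insertNijenhuis (PowerSeries.coeff ij.1 A) (PowerSeries.coeff ij.2 A) η)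
  - lieOp (PowerSeries.coeff k (A * A)) η

/-- `Ad_{ρ̂_A} P = [ρ̂_A, P]` for power series of operators. -/
def adRho (A : PowerSeries (EndField n X)) {p : ℕ} (P : OpSeries n X p (p + 1)) :
    OpSeries n X p (p + 1) := fun k η =>
  ∑ ij ∈ Finset.HasAntidiagonal.antidiagonal k,
    (rhoHat (PowerSeries.coeff ij.1 A) (P ij.2 η) - P ij.2 (rhoHat (PowerSeries.coeff ij.1 A) η))

/-- The power series `f(x) = -1/2! + x/3! - x²/4! + ⋯`. -/
def fSeries : PowerSeries ℝ :=
  PowerSeries.mk fun m => (-1 : ℝ) ^ (m + 1) / ((m + 2).factorial : ℝ)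

/-- `f(Ad_{ρ̂_A}) G(A,A)` as a power series of operators, for `A` without constant term; then
`Ad_{ρ̂_A}^m G(A,A)` has no terms of degree less than `m + 2`, so that each sum is finite. -/
def fAdG (A : PowerSeries (EndField n X)) {p : ℕ} : OpSeries n X p (p + 1) := fun k η =>
  ∑ᶠ m : ℕ, PowerSeries.coeff m fSeries • ((adRho A)^[m] (GSeries A)) k η

/-- `Φ = (φ_1, …, φ_l)` is a smooth section of the bundle with fibre the orbit of `ΦV`, transported
to each tangent space by a linear identification with `V`. -/
def IsOrbitSection {V : Type*} [NormedAddCommGroup V] [NormedSpace ℝ V] {l : ℕ} {p : Fin l → ℕ}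
    (ΦV : ∀ i, V [⋀^Fin (p i)]→L[ℝ] ℝ) (Φ : ∀ i, FormField n X (p i)) : Prop :=
  (∀ i, IsSmoothForm (Φ i)) ∧ ∀ x : X, ∃ h : Model n ≃L[ℝ] V,
    (fun i => (Φ i x).compContinuousLinearMap (h.symm : V →L[ℝ] Model n)) ∈ glOrbit ΦV

/-- `Ψ ∈ Γ(E²)`: a smooth tuple of forms with values in the spaces `E²(T_x X)` defined by `Φ`. -/
def IsSectionE2 {l : ℕ} {p : Fin l → ℕ} (Φ : ∀ i, FormField n X (p i))
    (Ψ : ∀ i, FormField n X (p i + 1)) : Prop :=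
  (∀ i, IsSmoothForm (Ψ i)) ∧ ∀ x : X, (fun i => Ψ i x) ∈ E2 fun i => Φ i x

end Manifold
end GaugeDef
end

open GaugeDef

/-!
The coefficients of `ρ_{exp a(t)}` are those of `e^{ρ̂_a}`: for an endomorphism `ξ`, both
`s ↦ ρ_{e^{sξ}}` and `s ↦ e^{s ρ̂_ξ}` solve the same linear differential equation. Now
`d e^{ρ̂_a} = e^{ρ̂_a} e^{-Ad ρ̂_a} d`, and `e^{ρ̂_a} = 1 + O(t)`, so that as long as the lower
coefficients of `d e^{ρ̂_a} Φ` vanish, the first possibly nonzero one is that of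
`(e^{-Ad ρ̂_a} d) Φ`. Its terms of degree at least two in `Ad ρ̂_a` come from
`[ρ̂_a, [ρ̂_a, d]] = -G(a,a)`, which is the polarised identity `[ρ̂_a, L_b] = L_{ba} - i_{N(a,b)}`;
its linear term is `d ρ̂_{a_k} Φ` because `dΦ = 0`.

Since `[ρ̂_ξ, i_M]` is again of the form `i_{M'}`, every coefficient of `Ad_{ρ̂_a}^m G(a,a)` is an
operator `i_M + L_b`, with the same `M` and `b` for forms of all degrees. The form `L_b Φ` is a
section of `E²` because `Φ` stays in one orbit: its first derivatives in a chart are tangent to the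
orbit, hence of the form `ρ̂_ξ Φ`.
-/

noncomputable section
namespace GaugeDef

section InfinitesimalAction

open ContinuousLinearMap (compL)
open ContinuousAlternatingMap (alternatizeUncurryFin alternatizeUncurryFinCLM
  alternatizeUncurryFin_apply alternatizeUncurryFin_add
  alternatizeUncurryFin_fderivCompContinuousLinearMap_eq_zero
  fderivCompContinuousLinearMapCLM fderivCompContinuousLinearMap_eq_alternatizeUncurryFin)

variable {E F : Type*} [NormedAddCommGroup E] [NormedSpace ℝ E] [NormedAddCommGroup F]
  [NormedSpace ℝ F] {p : ℕ}

/-- The infinitesimal action `(φ, ξ) ↦ ρ̂_ξ φ` as a continuous bilinear map, through which it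
inherits additivity and differentiability in both arguments. -/
def infActionCLM (E : Type*) [NormedAddCommGroup E] [NormedSpace ℝ E] (p : ℕ) :
    (E [⋀^Fin p]→L[ℝ] ℝ) →L[ℝ] (E →L[ℝ] E) →L[ℝ] E [⋀^Fin p]→L[ℝ] ℝ :=
  fderivCompContinuousLinearMapCLM ℝ (ContinuousLinearMap.id ℝ E)

theorem infActionCLM_apply (φ : E [⋀^Fin p]→L[ℝ] ℝ) (ξ : E →L[ℝ] E) :
    infActionCLM E p φ ξ = infAction ξ φ := rfl

theorem infAction_add_left (ξ ζ : E →L[ℝ] E) (φ : E [⋀^Fin p]→L[ℝ] ℝ) :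
    infAction (ξ + ζ) φ = infAction ξ φ + infAction ζ φ :=
  map_add (infActionCLM E p φ) ξ ζ

theorem infAction_smul_left (c : ℝ) (ξ : E →L[ℝ] E) (φ : E [⋀^Fin p]→L[ℝ] ℝ) :
    infAction (c • ξ) φ = c • infAction ξ φ :=
  map_smul (infActionCLM E p φ) c ξ

theorem infAction_zero_left (φ : E [⋀^Fin p]→L[ℝ] ℝ) : infAction (0 : E →L[ℝ] E) φ = 0 :=
  map_zero (infActionCLM E p φ)

theorem infAction_add (ξ : E →L[ℝ] E) (φ ψ : E [⋀^Fin p]→L[ℝ] ℝ) :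
    infAction ξ (φ + ψ) = infAction ξ φ + infAction ξ ψ :=
  map_add ((infActionCLM E p).flip ξ) φ ψ

theorem infAction_sub (ξ : E →L[ℝ] E) (φ ψ : E [⋀^Fin p]→L[ℝ] ℝ) :
    infAction ξ (φ - ψ) = infAction ξ φ - infAction ξ ψ :=
  map_sub ((infActionCLM E p).flip ξ) φ ψ

theorem infAction_smul (c : ℝ) (ξ : E →L[ℝ] E) (φ : E [⋀^Fin p]→L[ℝ] ℝ) :
    infAction ξ (c • φ) = c • infAction ξ φ :=
  map_smul ((infActionCLM E p).flip ξ) c φ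

theorem infAction_zero (ξ : E →L[ℝ] E) : infAction ξ (0 : E [⋀^Fin p]→L[ℝ] ℝ) = 0 :=
  map_zero ((infActionCLM E p).flip ξ)

theorem compContinuousLinearMap_infAction {ξ : E →L[ℝ] E} {ζ : F →L[ℝ] F} {T : F →L[ℝ] E}
    (h : T ∘L ζ = ξ ∘L T) (φ : E [⋀^Fin p]→L[ℝ] ℝ) :
    (infAction ξ φ).compContinuousLinearMap T = infAction ζ (φ.compContinuousLinearMap T) := by
  ext u
  simp only [ContinuousAlternatingMap.compContinuousLinearMap_apply, infAction_apply]
  refine Finset.sum_congr rfl fun i _ => congrArg φ ?_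
  rw [Function.comp_update, Function.comp_apply, ← ContinuousLinearMap.comp_apply, ← h]
  rfl

theorem infAction_infAction_apply (ξ ζ : E →L[ℝ] E) (φ : E [⋀^Fin p]→L[ℝ] ℝ) (u : Fin p → E) :
    infAction ξ (infAction ζ φ) u = ∑ i, φ (Function.update u i (ζ (ξ (u i)))) +
      ∑ i, ∑ j ∈ Finset.univ.erase i,
        φ (Function.update (Function.update u i (ξ (u i))) j (ζ (u j))) := by
  simp only [infAction_apply, ← Finset.sum_add_distrib]
  refine Finset.sum_congr rfl fun i _ => ?_
  rw [← Finset.add_sum_erase _ _ (Finset.mem_univ i), Function.update_self, Function.update_idem]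
  congr 1
  refine Finset.sum_congr rfl fun j hj => ?_
  rw [Function.update_of_ne (Finset.ne_of_mem_erase hj)]

-- The order on the right is reversed because `ρ` is a right action.
theorem infAction_commutator (ξ ζ : E →L[ℝ] E) (φ : E [⋀^Fin p]→L[ℝ] ℝ) :
    infAction ξ (infAction ζ φ) - infAction ζ (infAction ξ φ) =
      infAction (ζ ∘L ξ - ξ ∘L ζ) φ := by
  ext u
  have mixed_terms_symm : ∑ i, ∑ j ∈ Finset.univ.erase i,
        φ (Function.update (Function.update u i (ξ (u i))) j (ζ (u j))) =
      ∑ i, ∑ j ∈ Finset.univ.erase i,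
        φ (Function.update (Function.update u i (ζ (u i))) j (ξ (u j))) := by
    rw [Finset.sum_comm' (t' := Finset.univ) (s' := fun j => Finset.univ.erase j)
      (by simp [eq_comm])]
    refine Finset.sum_congr rfl fun i _ => Finset.sum_congr rfl fun j hj => ?_
    rw [Function.update_comm (Finset.ne_of_mem_erase hj)]
  rw [ContinuousAlternatingMap.sub_apply, infAction_infAction_apply, infAction_infAction_apply,
    mixed_terms_symm, add_sub_add_right_eq_sub]
  simp only [infAction_apply, sub_apply, ContinuousLinearMap.comp_apply,
    φ.map_update_sub, Finset.sum_sub_distrib]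

theorem infAction_alternatizeUncurryFin (ξ : E →L[ℝ] E) (T : E →L[ℝ] E [⋀^Fin p]→L[ℝ] ℝ) :
    infAction ξ (alternatizeUncurryFin T) =
      alternatizeUncurryFin (T ∘L ξ + (infActionCLM E p).flip ξ ∘L T) := by
  ext u
  simp only [infAction_apply, alternatizeUncurryFin_apply, add_apply,
    ContinuousLinearMap.comp_apply, ContinuousLinearMap.flip_apply, infActionCLM_apply,
    ContinuousAlternatingMap.add_apply]
  rw [Finset.sum_comm]
  refine Finset.sum_congr rfl fun j _ => ?_
  rw [← Finset.smul_sum, Fin.sum_univ_succAbove _ j]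
  simp [Fin.removeNth_update_succAbove, Function.update_of_ne, (Fin.succAbove_ne _ _).symm,
    Fin.removeNth_apply]

/-- The operator `M ↦ ∑ e^i ∧ ρ̂_{M(e_i)} φ` for `M ∈ E* ⊗ End(E)`, where `(e_i)` is any basis of
`E` and `(e^i)` the dual one. -/
def wedgeAction (φ : E [⋀^Fin p]→L[ℝ] ℝ) :
    (E →L[ℝ] E →L[ℝ] E) →ₗ[ℝ] E [⋀^Fin (p + 1)]→L[ℝ] ℝ :=
  (alternatizeUncurryFinCLM ℝ E ℝ ∘L (infActionCLM E p φ).postcomp E).toLinearMap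

theorem wedgeAction_apply (φ : E [⋀^Fin p]→L[ℝ] ℝ) (M : E →L[ℝ] E →L[ℝ] E) :
    wedgeAction φ M = alternatizeUncurryFin (infActionCLM E p φ ∘L M) := rfl

theorem wedgeAction_sum {ι : Type*} (φ : E [⋀^Fin p]→L[ℝ] ℝ) (s : Finset ι)
    (M : ι → E →L[ℝ] E →L[ℝ] E) : wedgeAction φ (∑ i ∈ s, M i) = ∑ i ∈ s, wedgeAction φ (M i) :=
  map_sum _ _ _

theorem wedgeAction_eq_zero_of_symm (φ : E [⋀^Fin p]→L[ℝ] ℝ) {M : E →L[ℝ] E →L[ℝ] E}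
    (hM : ∀ u v, M u v = M v u) : wedgeAction φ M = 0 :=
  alternatizeUncurryFin_fderivCompContinuousLinearMap_eq_zero φ _ hM

theorem wedgeAction_flip (φ : E [⋀^Fin p]→L[ℝ] ℝ) (M : E →L[ℝ] E →L[ℝ] E) :
    wedgeAction φ M.flip = -wedgeAction φ M := by
  rw [eq_neg_iff_add_eq_zero, ← map_add]
  exact wedgeAction_eq_zero_of_symm φ fun u v => add_comm (M v u) (M u v)

theorem insertTwoForm_eq_wedgeAction (N : E →L[ℝ] E →L[ℝ] E) (φ : E [⋀^Fin p]→L[ℝ] ℝ) :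
    insertTwoForm N φ = (1 / 2 : ℝ) • wedgeAction φ N := by
  cases p with
  | zero =>
    ext u
    simp [insertTwoForm, wedgeAction_apply, alternatizeUncurryFin_apply, infActionCLM_apply,
      infAction_apply]
  | succ q =>
    rw [insertTwoForm, altTwo, wedgeAction_apply]
    congr 2
    ext u v : 2
    change _ = φ.fderivCompContinuousLinearMap (ContinuousLinearMap.id ℝ E) (N u) v
    rw [fderivCompContinuousLinearMap_eq_alternatizeUncurryFin]
    rfl

theorem insertTwoForm_sub_flip (M : E →L[ℝ] E →L[ℝ] E) (φ : E [⋀^Fin p]→L[ℝ] ℝ) :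
    insertTwoForm (M - M.flip) φ = wedgeAction φ M := by
  rw [insertTwoForm_eq_wedgeAction, map_sub, wedgeAction_flip]
  module

theorem infAction_wedgeAction_commutator (ξ : E →L[ℝ] E) (M : E →L[ℝ] E →L[ℝ] E)
    (φ : E [⋀^Fin p]→L[ℝ] ℝ) :
    infAction ξ (wedgeAction φ M) - wedgeAction (infAction ξ φ) M =
      wedgeAction φ (M ∘L ξ + ((compL ℝ E E E).flip ξ ∘L M - compL ℝ E E E ξ ∘L M)) := by
  simp only [wedgeAction_apply, infAction_alternatizeUncurryFin]
  rw [sub_eq_iff_eq_add, ← alternatizeUncurryFin_add]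
  congr 1
  ext u : 1
  change infAction (M (ξ u)) φ + infAction ξ (infAction (M u) φ) =
    infAction (M (ξ u) + (M u ∘L ξ - ξ ∘L M u)) φ + infAction (M u) (infAction ξ φ)
  rw [infAction_add_left, ← infAction_commutator]
  abel

theorem wedgeInterior_eq_insertTwoForm (α : E →L[ℝ] E →L[ℝ] ℝ) (v : E)
    (φ : E [⋀^Fin p]→L[ℝ] ℝ) :
    wedgeInterior α v φ =
      insertTwoForm ((ContinuousLinearMap.toSpanSingleton ℝ v).postcomp E ∘L α) φ := by
  cases p with
  | zero => rfl
  | succ q =>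
    rw [wedgeInterior, insertTwoForm]
    congr 1
    ext u w : 2
    exact (φ.curryLeft.map_smul (α u w) v).symm

theorem wedgeAction_mem_E2 [FiniteDimensional ℝ E] {l : ℕ} {p : Fin l → ℕ}
    (Φ : ∀ i, E [⋀^Fin (p i)]→L[ℝ] ℝ) (M : E →L[ℝ] E →L[ℝ] E) :
    (fun i => wedgeAction (Φ i) M) ∈ E2 Φ := by
  let e := Module.finBasis ℝ E
  let N := M - M.flip
  let α (j) : E →L[ℝ] E →L[ℝ] ℝ := (e.coord j).toContinuousLinearMap.postcomp E ∘L N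
  have hN : N = ∑ j, (ContinuousLinearMap.toSpanSingleton ℝ (e j)).postcomp E ∘L α j := by
    ext u w : 2
    rw [sum_apply, sum_apply]
    exact (e.sum_repr (N u w)).symm
  have h : (fun i => wedgeAction (Φ i) M) = ∑ j, fun i => wedgeInterior (α j) (e j) (Φ i) := by
    funext i
    rw [← insertTwoForm_sub_flip, Finset.sum_apply]
    simp only [wedgeInterior_eq_insertTwoForm, insertTwoForm_eq_wedgeAction, ← Finset.smul_sum,
      ← map_sum, ← hN, N]
  rw [h]
  refine Submodule.sum_mem _ fun j _ => Submodule.subset_span ⟨α j, fun u => ?_, e j, rfl⟩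
  change e.coord j (M u u - M u u) = 0
  rw [sub_self, map_zero]

end InfinitesimalAction

section LieJet

open ContinuousLinearMap (compL)
open ContinuousAlternatingMap (alternatizeUncurryFin alternatizeUncurryFin_add)

variable {E : Type*} [NormedAddCommGroup E] [NormedSpace ℝ E] {p : ℕ}

theorem hasFDerivAt_infAction {b : E → E →L[ℝ] E} {η : E → E [⋀^Fin p]→L[ℝ] ℝ}
    {b' : E →L[ℝ] E →L[ℝ] E} {η' : E →L[ℝ] E [⋀^Fin p]→L[ℝ] ℝ} {y : E}
    (hb : HasFDerivAt b b' y) (hη : HasFDerivAt η η' y) :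
    HasFDerivAt (fun z => infAction (b z) (η z))
      (infActionCLM E p (η y) ∘L b' + (infActionCLM E p).flip (b y) ∘L η') y :=
  (infActionCLM E p).hasFDerivAt_of_bilinear hη hb

/-- The value of `L_b η = [ρ̂_b, d] η` at a point of a vector space, in terms of the values `b`, `φ`
and the derivatives `b'`, `φ'` of the field `b` and the form `η` at this point; see
`infAction_extDeriv_sub`. -/
def lieJet (b : E →L[ℝ] E) (b' : E →L[ℝ] E →L[ℝ] E) (φ : E [⋀^Fin p]→L[ℝ] ℝ)
    (φ' : E →L[ℝ] E [⋀^Fin p]→L[ℝ] ℝ) : E [⋀^Fin (p + 1)]→L[ℝ] ℝ :=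
  alternatizeUncurryFin (φ' ∘L b) - wedgeAction φ b'

theorem infAction_extDeriv_sub {b : E → E →L[ℝ] E} {η : E → E [⋀^Fin p]→L[ℝ] ℝ} {y : E}
    (hb : DifferentiableAt ℝ b y) (hη : DifferentiableAt ℝ η y) :
    infAction (b y) (extDeriv η y) - extDeriv (fun z => infAction (b z) (η z)) y =
      lieJet (b y) (fderiv ℝ b y) (η y) (fderiv ℝ η y) := by
  rw [extDeriv, extDeriv, (hasFDerivAt_infAction hb.hasFDerivAt hη.hasFDerivAt).fderiv,
    infAction_alternatizeUncurryFin, alternatizeUncurryFin_add, alternatizeUncurryFin_add,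
    lieJet, wedgeAction_apply]
  abel

-- If `φ'` is the action of endomorphisms, as for a section of a bundle of orbits, then the first
-- order term of `L_b` becomes algebraic.
theorem lieJet_infActionCLM_comp (b : E →L[ℝ] E) (b' T : E →L[ℝ] E →L[ℝ] E)
    (φ : E [⋀^Fin p]→L[ℝ] ℝ) :
    lieJet b b' φ (infActionCLM E p φ ∘L T) = wedgeAction φ (T ∘L b - b') := by
  rw [map_sub]
  rfl

/-- The tensor `M` in `[ρ̂_a, L_b] = L_{ba} - ∑ e^i ∧ ρ̂_{M(e_i)}`, in terms of the values and
derivatives of `a` and `b`. Its skew part is the Nijenhuis tensor `N(a, b)`. -/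
def commutatorTensor (a b : E →L[ℝ] E) (a' b' : E →L[ℝ] E →L[ℝ] E) : E →L[ℝ] E →L[ℝ] E :=
  b' ∘L a + a' ∘L b - compL ℝ E E E a ∘L b' - compL ℝ E E E b ∘L a'

theorem commutatorTensor_apply (a b : E →L[ℝ] E) (a' b' : E →L[ℝ] E →L[ℝ] E) (u v : E) :
    commutatorTensor a b a' b' u v = b' (a u) v + a' (b u) v - a (b' u v) - b (a' u v) := rfl

theorem infAction_lieJet_commutator (a b : E →L[ℝ] E) (a' b' : E →L[ℝ] E →L[ℝ] E)
    (φ : E [⋀^Fin p]→L[ℝ] ℝ) (φ' : E →L[ℝ] E [⋀^Fin p]→L[ℝ] ℝ) :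
    infAction a (lieJet b b' φ φ') -
        lieJet b b' (infAction a φ) (infActionCLM E p φ ∘L a' + (infActionCLM E p).flip a ∘L φ') =
      lieJet (b ∘L a) ((compL ℝ E E E).flip a ∘L b' + compL ℝ E E E b ∘L a') φ φ' -
        wedgeAction φ (commutatorTensor a b a' b') := by
  have h := eq_add_of_sub_eq (infAction_wedgeAction_commutator a b' φ)
  simp only [lieJet, infAction_sub, infAction_alternatizeUncurryFin, h, commutatorTensor, map_add,
    map_sub]
  simp only [wedgeAction_apply, alternatizeUncurryFin_add, ContinuousLinearMap.add_comp,
    ContinuousLinearMap.comp_assoc]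
  abel

end LieJet

section Charts

variable {n : ℕ} {X : Type*} [TopologicalSpace X] [ChartedSpace (Model n) X] {p : ℕ}

theorem IsSmoothForm.add {η θ : FormField n X p} (hη : IsSmoothForm η) (hθ : IsSmoothForm θ) :
    IsSmoothForm (η + θ) := fun x₀ => (hη x₀).add (hθ x₀)

theorem IsSmoothForm.const_smul {η : FormField n X p} (hη : IsSmoothForm η) (c : ℝ) :
    IsSmoothForm (c • η) := fun x₀ => (hη x₀).const_smul c

theorem isSmoothForm_zero : IsSmoothForm (0 : FormField n X p) := fun _ => contDiffOn_const (c := 0)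

theorem IsSmoothForm.sum {ι : Type*} {s : Finset ι} {η : ι → FormField n X p}
    (hη : ∀ i ∈ s, IsSmoothForm (η i)) : IsSmoothForm (∑ i ∈ s, η i) :=
  Finset.sum_induction _ _ (fun _ _ => IsSmoothForm.add) isSmoothForm_zero hη

theorem IsSmoothForm.differentiableAt_chartForm {η : FormField n X p} (hη : IsSmoothForm η)
    (x : X) : DifferentiableAt ℝ (chartForm η x) (extChartAt (𝓡 n) x x) :=
  ((hη x).contDiffAt (extChartAt_target_mem_nhds x)).differentiableAt (by simp)

theorem chartInvDeriv_eq_mfderivWithin (x₀ : X) (y : Model n) : chartInvDeriv x₀ y =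
    mfderivWithin 𝓘(ℝ, Model n) (𝓡 n) (extChartAt (𝓡 n) x₀).symm (Set.range (𝓡 n)) y := by
  rw [ModelWithCorners.range_eq_univ, mfderivWithin_univ]
  rfl

/-- The derivative at `x` of the preferred chart at another point `x₀`. -/
def chartDerivAt (x₀ x : X) : Model n →L[ℝ] Model n :=
  mfderiv (𝓡 n) 𝓘(ℝ, Model n) (extChartAt (𝓡 n) x₀) x

variable [IsManifold (𝓡 n) ∞ X]

theorem chartDerivAt_comp_chartInvDeriv {x₀ : X} {y : Model n}
    (hy : y ∈ (extChartAt (𝓡 n) x₀).target) :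
    chartDerivAt x₀ ((extChartAt (𝓡 n) x₀).symm y) ∘L chartInvDeriv x₀ y =
      ContinuousLinearMap.id ℝ _ := by
  rw [chartInvDeriv_eq_mfderivWithin]
  exact mfderiv_extChartAt_comp_mfderivWithin_extChartAt_symm hy

theorem chartInvDeriv_comp_chartDerivAt {x₀ : X} {y : Model n}
    (hy : y ∈ (extChartAt (𝓡 n) x₀).target) :
    chartInvDeriv x₀ y ∘L chartDerivAt x₀ ((extChartAt (𝓡 n) x₀).symm y) =
      ContinuousLinearMap.id ℝ _ := by
  rw [chartInvDeriv_eq_mfderivWithin]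
  exact mfderivWithin_extChartAt_symm_comp_mfderiv_extChartAt hy

theorem chartDerivAt_self (x : X) : chartDerivAt x x = ContinuousLinearMap.id ℝ (Model n) :=
  mfderiv_extChartAt_self

theorem chartInvDeriv_self (x : X) :
    chartInvDeriv x (extChartAt (𝓡 n) x x) = ContinuousLinearMap.id ℝ (Model n) := by
  rw [chartInvDeriv_eq_mfderivWithin]
  exact mfderivWithin_range_extChartAt_symm

theorem chartForm_self (η : FormField n X p) (x : X) :
    chartForm η x (extChartAt (𝓡 n) x x) = η x := by
  rw [chartForm, chartInvDeriv_self, extChartAt_to_inv]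
  rfl

theorem extD_apply (η : FormField n X p) (x : X) :
    extD η x = extDeriv (chartForm η x) (extChartAt (𝓡 n) x x) := by
  rw [extD, show chartDeriv x = _ from chartDerivAt_self x]
  rfl

theorem extD_add {η θ : FormField n X p} (hη : IsSmoothForm η) (hθ : IsSmoothForm θ) :
    extD (η + θ) = extD η + extD θ := by
  funext x
  rw [Pi.add_apply, extD_apply, extD_apply, extD_apply,
    ← extDeriv_add (hη.differentiableAt_chartForm x) (hθ.differentiableAt_chartForm x)]
  rfl

theorem extD_smul (c : ℝ) (η : FormField n X p) : extD (c • η) = c • extD η := by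
  funext x
  rw [Pi.smul_apply, extD_apply, extD_apply, ← extDeriv_smul]
  rfl

theorem extD_zero : extD (0 : FormField n X p) = 0 := by
  rw [← zero_smul ℝ (0 : FormField n X p), extD_smul, zero_smul]

theorem extD_sum {ι : Type*} {s : Finset ι} {η : ι → FormField n X p}
    (hη : ∀ i ∈ s, IsSmoothForm (η i)) : extD (∑ i ∈ s, η i) = ∑ i ∈ s, extD (η i) := by
  induction s using Finset.cons_induction with
  | empty => exact extD_zero
  | cons i s hi ih =>
    rw [Finset.forall_mem_cons] at hη
    rw [Finset.sum_cons, Finset.sum_cons, extD_add hη.1 (.sum hη.2), ih hη.2]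

/-- The transition map from the preferred chart at `x₀` to the preferred chart at `x`. -/
def chartTransition (x₀ x : X) : Model n → Model n :=
  extChartAt (𝓡 n) x ∘ (extChartAt (𝓡 n) x₀).symm

theorem mdifferentiableAt_extChartAt_symm {x₀ : X} {y : Model n}
    (hy : y ∈ (extChartAt (𝓡 n) x₀).target) :
    MDifferentiableAt 𝓘(ℝ, Model n) (𝓡 n) (extChartAt (𝓡 n) x₀).symm y := by
  have := mdifferentiableWithinAt_extChartAt_symm (I := 𝓡 n) hy
  rwa [ModelWithCorners.range_eq_univ, mdifferentiableWithinAt_univ] at this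

theorem fderiv_chartTransition {x₀ x : X} {y : Model n} (hy : y ∈ (extChartAt (𝓡 n) x₀).target)
    (hx : (extChartAt (𝓡 n) x₀).symm y ∈ (extChartAt (𝓡 n) x).source) :
    fderiv ℝ (chartTransition x₀ x) y =
      chartDerivAt x ((extChartAt (𝓡 n) x₀).symm y) ∘L chartInvDeriv x₀ y := by
  rw [extChartAt_source] at hx
  rw [← mfderiv_eq_fderiv]
  exact mfderiv_comp y (mdifferentiableAt_extChartAt hx) (mdifferentiableAt_extChartAt_symm hy)

theorem contDiffAt_chartTransition {x₀ x : X} {y : Model n}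
    (hy : y ∈ (extChartAt (𝓡 n) x₀).target)
    (hx : (extChartAt (𝓡 n) x₀).symm y ∈ (extChartAt (𝓡 n) x).source) :
    ContDiffAt ℝ ∞ (chartTransition x₀ x) y := by
  have h := contDiffWithinAt_ext_coord_change (I := 𝓡 n) (n := ∞) x x₀ (y := y) (by
    rw [PartialEquiv.trans_source'', PartialEquiv.symm_symm, PartialEquiv.symm_target]
    exact ⟨_, ⟨(extChartAt (𝓡 n) x₀).map_target hy, hx⟩, (extChartAt (𝓡 n) x₀).right_inv hy⟩)
  rwa [ModelWithCorners.range_eq_univ, contDiffWithinAt_univ] at h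

theorem chartForm_eq_pullback_chartTransition (η : FormField n X p) {x₀ x : X} {y : Model n}
    (hy : y ∈ (extChartAt (𝓡 n) x₀).target)
    (hx : (extChartAt (𝓡 n) x₀).symm y ∈ (extChartAt (𝓡 n) x).source) :
    chartForm η x₀ y = (chartForm η x (chartTransition x₀ x y)).compContinuousLinearMap
      (fderiv ℝ (chartTransition x₀ x) y) := by
  have symm_transition : (extChartAt (𝓡 n) x).symm (chartTransition x₀ x y) =
      (extChartAt (𝓡 n) x₀).symm y := (extChartAt (𝓡 n) x).left_inv hx
  have h := chartInvDeriv_comp_chartDerivAt ((extChartAt (𝓡 n) x).map_source hx)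
  rw [(extChartAt (𝓡 n) x).left_inv hx] at h
  have comp_fderiv : chartInvDeriv x (chartTransition x₀ x y) ∘L
      fderiv ℝ (chartTransition x₀ x) y = chartInvDeriv x₀ y := by
    rw [fderiv_chartTransition hy hx, ← ContinuousLinearMap.comp_assoc]
    exact congrArg (· ∘L chartInvDeriv x₀ y) h
  rw [chartForm, chartForm, symm_transition, ← comp_fderiv]
  rfl

-- `extD` is computed at each point in the preferred chart there; this is its independence of
-- the chart.
theorem chartForm_extD {η : FormField n X p} (hη : IsSmoothForm η) {x₀ : X} {y : Model n}
    (hy : y ∈ (extChartAt (𝓡 n) x₀).target) :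
    chartForm (extD η) x₀ y = extDeriv (chartForm η x₀) y := by
  set x := (extChartAt (𝓡 n) x₀).symm y with hx
  have hxs : (extChartAt (𝓡 n) x₀).symm y ∈ (extChartAt (𝓡 n) x).source := mem_extChartAt_source x
  have hτy : chartTransition x₀ x y = extChartAt (𝓡 n) x x := rfl
  have eventually_eq_pullback : chartForm η x₀ =ᶠ[nhds y] fun z =>
      (chartForm η x (chartTransition x₀ x z)).compContinuousLinearMap
        (fderiv ℝ (chartTransition x₀ x) z) := by
    filter_upwards [(isOpen_extChartAt_target x₀).mem_nhds hy,
      (mdifferentiableAt_extChartAt_symm hy).continuousAt.eventually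
        ((isOpen_extChartAt_source x).mem_nhds hxs)] with z hz hzs
    exact chartForm_eq_pullback_chartTransition η hz hzs
  rw [eventually_eq_pullback.extDeriv_eq,
    extDeriv_pullback (r := ∞) (hτy ▸ hη.differentiableAt_chartForm x)
      (contDiffAt_chartTransition hy hxs)
      (by rw [minSmoothness_of_isRCLikeNormedField]; exact WithTop.coe_le_coe.2 le_top),
    fderiv_chartTransition hy hxs, chartForm, extD, ← hx, hτy]
  rfl

theorem IsSmoothForm.extD {η : FormField n X p} (hη : IsSmoothForm η) :
    IsSmoothForm (extD η) := by
  intro x₀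
  refine ContDiffOn.congr ?_ fun y hy => chartForm_extD hη hy
  exact (ContinuousAlternatingMap.alternatizeUncurryFinCLM ℝ (Model n) ℝ).contDiff.comp_contDiffOn
    ((hη x₀).fderiv_of_isOpen (isOpen_extChartAt_target x₀) (m := ∞) (by rfl))

/-- A field of endomorphisms in the preferred chart at `x₀`. -/
def chartEnd (b : EndField n X) (x₀ : X) (y : Model n) : Model n →L[ℝ] Model n :=
  chartDerivAt x₀ ((extChartAt (𝓡 n) x₀).symm y) ∘L b.val ((extChartAt (𝓡 n) x₀).symm y) ∘L
    chartInvDeriv x₀ y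

theorem chartEnd_self (b : EndField n X) (x : X) :
    chartEnd b x (extChartAt (𝓡 n) x x) = b.val x := by
  rw [chartEnd, chartInvDeriv_self, extChartAt_to_inv, chartDerivAt_self]
  rfl

theorem chartInvDeriv_comp_chartEnd (b : EndField n X) {x₀ : X} {y : Model n}
    (hy : y ∈ (extChartAt (𝓡 n) x₀).target) :
    chartInvDeriv x₀ y ∘L chartEnd b x₀ y =
      b.val ((extChartAt (𝓡 n) x₀).symm y) ∘L chartInvDeriv x₀ y := by
  rw [chartEnd, ← ContinuousLinearMap.comp_assoc, chartInvDeriv_comp_chartDerivAt hy]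
  rfl

theorem chartEnd_mul (a b : EndField n X) {x₀ : X} {y : Model n}
    (hy : y ∈ (extChartAt (𝓡 n) x₀).target) :
    chartEnd (a * b) x₀ y = chartEnd a x₀ y ∘L chartEnd b x₀ y := by
  rw [chartEnd, chartEnd, ContinuousLinearMap.comp_assoc, ContinuousLinearMap.comp_assoc,
    chartInvDeriv_comp_chartEnd b hy]
  rfl

theorem chartEnd_eq_trivializationAt (b : EndField n X) {x₀ : X} {y : Model n}
    (hy : y ∈ (extChartAt (𝓡 n) x₀).target) :
    chartEnd b x₀ y = (trivializationAt (Model n →L[ℝ] Model n)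
      (fun x : X => TangentSpace (𝓡 n) x →L[ℝ] TangentSpace (𝓡 n) x) x₀
        ⟨(extChartAt (𝓡 n) x₀).symm y, b ((extChartAt (𝓡 n) x₀).symm y)⟩).2 := by
  have hx : (extChartAt (𝓡 n) x₀).symm y ∈ (chartAt (Model n) x₀).source := by
    simpa using (extChartAt (𝓡 n) x₀).map_target hy
  have hsymm := TangentBundle.symmL_trivializationAt (I := 𝓡 n) hx
  rw [(extChartAt (𝓡 n) x₀).right_inv hy] at hsymm
  rw [chartEnd, chartInvDeriv_eq_mfderivWithin, chartDerivAt, hom_trivializationAt_apply]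
  change _ = (trivializationAt (Model n) (TangentSpace (𝓡 n)) x₀).continuousLinearMapAt ℝ _ ∘L
    b ((extChartAt (𝓡 n) x₀).symm y) ∘L
    (trivializationAt (Model n) (TangentSpace (𝓡 n)) x₀).symmL ℝ _
  rw [TangentBundle.continuousLinearMapAt_trivializationAt (I := 𝓡 n) hx, hsymm]
  rfl

theorem contDiffOn_chartEnd (b : EndField n X) (x₀ : X) :
    ContDiffOn ℝ ∞ (chartEnd b x₀) (extChartAt (𝓡 n) x₀).target := by
  have smooth_in_trivialization := ((trivializationAt (Model n →L[ℝ] Model n)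
    (fun x : X => TangentSpace (𝓡 n) x →L[ℝ] TangentSpace (𝓡 n) x)
      x₀).contMDiffOn_section_baseSet_iff (IB := 𝓡 n) (n := ∞)).1 b.contMDiff.contMDiffOn
  have h := smooth_in_trivialization.comp (contMDiffOn_extChartAt_symm (I := 𝓡 n) (n := ∞) x₀)
    fun y hy => by simpa using (extChartAt (𝓡 n) x₀).map_target hy
  exact h.contDiffOn.congr fun y hy => chartEnd_eq_trivializationAt b hy

theorem differentiableAt_chartEnd (b : EndField n X) (x : X) :
    DifferentiableAt ℝ (chartEnd b x) (extChartAt (𝓡 n) x x) :=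
  ((contDiffOn_chartEnd b x).contDiffAt (extChartAt_target_mem_nhds x)).differentiableAt (by simp)

theorem chartForm_rhoHat (b : EndField n X) (η : FormField n X p) {x₀ : X} {y : Model n}
    (hy : y ∈ (extChartAt (𝓡 n) x₀).target) :
    chartForm (rhoHat b η) x₀ y = infAction (chartEnd b x₀ y) (chartForm η x₀ y) :=
  compContinuousLinearMap_infAction (chartInvDeriv_comp_chartEnd b hy) _

theorem IsSmoothForm.rhoHat {η : FormField n X p} (hη : IsSmoothForm η) (b : EndField n X) :
    IsSmoothForm (rhoHat b η) := by
  intro x₀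
  refine ContDiffOn.congr ?_ fun y hy => chartForm_rhoHat b η hy
  exact (infActionCLM (Model n) p).isBoundedBilinearMap.contDiff.comp₂_contDiffOn (hη x₀)
    (contDiffOn_chartEnd b x₀)

end Charts

section Commutators

open ContinuousLinearMap (compL)
open VectorField (mlieBracket lieBracket mpullbackWithin)

variable {n : ℕ} {X : Type*} [TopologicalSpace X] [ChartedSpace (Model n) X]
  [IsManifold (𝓡 n) ∞ X] {p : ℕ}

/-- The derivative at `x` of a form in the preferred chart at `x`. -/
def chartFormDeriv (η : FormField n X p) (x : X) : Model n →L[ℝ] Model n [⋀^Fin p]→L[ℝ] ℝ :=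
  fderiv ℝ (chartForm η x) (extChartAt (𝓡 n) x x)

/-- The derivative at `x` of a field of endomorphisms in the preferred chart at `x`. -/
def chartEndDeriv (b : EndField n X) (x : X) : Model n →L[ℝ] Model n →L[ℝ] Model n :=
  fderiv ℝ (chartEnd b x) (extChartAt (𝓡 n) x x)

theorem chartForm_rhoHat_eventuallyEq (b : EndField n X) (η : FormField n X p) (x : X) :
    chartForm (rhoHat b η) x =ᶠ[nhds (extChartAt (𝓡 n) x x)]
      fun y => infAction (chartEnd b x y) (chartForm η x y) := by
  filter_upwards [extChartAt_target_mem_nhds x] with y hy using chartForm_rhoHat b η hy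

theorem chartFormDeriv_rhoHat (b : EndField n X) {η : FormField n X p} (hη : IsSmoothForm η)
    (x : X) : chartFormDeriv (rhoHat b η) x =
      infActionCLM (Model n) p (η x) ∘L chartEndDeriv b x +
        (infActionCLM (Model n) p).flip (b.val x) ∘L chartFormDeriv η x := by
  rw [chartFormDeriv, (chartForm_rhoHat_eventuallyEq b η x).fderiv_eq,
    (hasFDerivAt_infAction (differentiableAt_chartEnd b x).hasFDerivAt
      (hη.differentiableAt_chartForm x).hasFDerivAt).fderiv, chartForm_self, chartEnd_self]
  rfl

theorem chartEndDeriv_mul (a b : EndField n X) (x : X) : chartEndDeriv (a * b) x =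
    compL ℝ _ _ _ (a.val x) ∘L chartEndDeriv b x +
      (compL ℝ _ _ _).flip (b.val x) ∘L chartEndDeriv a x := by
  have h : chartEnd (a * b) x =ᶠ[nhds (extChartAt (𝓡 n) x x)]
      fun y => chartEnd a x y ∘L chartEnd b x y := by
    filter_upwards [extChartAt_target_mem_nhds x] with y hy using chartEnd_mul a b hy
  rw [chartEndDeriv, h.fderiv_eq, ((differentiableAt_chartEnd a x).hasFDerivAt.clm_comp
    (differentiableAt_chartEnd b x).hasFDerivAt).fderiv, chartEnd_self, chartEnd_self]
  rfl

theorem chartEndDeriv_one (x : X) : chartEndDeriv (1 : EndField n X) x = 0 := by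
  have h : chartEnd (1 : EndField n X) x =ᶠ[nhds (extChartAt (𝓡 n) x x)]
      fun _ => ContinuousLinearMap.id ℝ (Model n) := by
    filter_upwards [extChartAt_target_mem_nhds x] with y hy
      using chartDerivAt_comp_chartInvDeriv hy
  rw [chartEndDeriv, h.fderiv_eq, fderiv_const_apply]

theorem lieOp_apply (b : EndField n X) {η : FormField n X p} (hη : IsSmoothForm η) (x : X) :
    lieOp b η x = lieJet (b.val x) (chartEndDeriv b x) (η x) (chartFormDeriv η x) := by
  have h := infAction_extDeriv_sub (differentiableAt_chartEnd b x)
    (hη.differentiableAt_chartForm x)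
  rwa [chartEnd_self, chartForm_self, ← extD_apply,
    ← (chartForm_rhoHat_eventuallyEq b η x).extDeriv_eq, ← extD_apply] at h

theorem mpullbackWithin_extChartAt_symm_eventuallyEq {x : X} {U : Π x : X, TangentSpace (𝓡 n) x}
    {W : Model n → Model n} (hU : ∀ᶠ y in nhds (extChartAt (𝓡 n) x x),
      U ((extChartAt (𝓡 n) x).symm y) = chartInvDeriv x y (W y)) :
    mpullbackWithin 𝓘(ℝ, Model n) (𝓡 n) (extChartAt (𝓡 n) x).symm U (Set.range (𝓡 n))
      =ᶠ[nhds (extChartAt (𝓡 n) x x)] W := by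
  filter_upwards [hU, extChartAt_target_mem_nhds x] with y hy hyt
  rw [VectorField.mpullbackWithin_apply, hy, chartInvDeriv_eq_mfderivWithin]
  exact (isInvertible_mfderivWithin_extChartAt_symm (I := 𝓡 n) hyt).inverse_apply_eq.2 rfl

theorem mlieBracket_eq_lieBracket {x : X} {U V : Π x : X, TangentSpace (𝓡 n) x}
    {W Z : Model n → Model n}
    (hU : ∀ᶠ y in nhds (extChartAt (𝓡 n) x x),
      U ((extChartAt (𝓡 n) x).symm y) = chartInvDeriv x y (W y))
    (hV : ∀ᶠ y in nhds (extChartAt (𝓡 n) x x),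
      V ((extChartAt (𝓡 n) x).symm y) = chartInvDeriv x y (Z y)) :
    mlieBracket (𝓡 n) U V x = lieBracket ℝ W Z (extChartAt (𝓡 n) x x) := by
  have inverse_chartDerivAt (w : Model n) : (chartDerivAt x x).inverse w = w := by
    rw [chartDerivAt_self, ContinuousLinearMap.inverse_id]
    rfl
  have domain_eq : (extChartAt (𝓡 n) x).symm ⁻¹' Set.univ ∩ Set.range (𝓡 n) = Set.univ := by
    rw [ModelWithCorners.range_eq_univ, Set.preimage_univ, Set.inter_univ]
  rw [← VectorField.mlieBracketWithin_univ, VectorField.mlieBracketWithin_apply, domain_eq,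
    ← VectorField.lieBracketWithin_univ]
  exact (inverse_chartDerivAt _).trans
    ((mpullbackWithin_extChartAt_symm_eventuallyEq hU).lieBracketWithin_vectorField_eq_nhds
      (mpullbackWithin_extChartAt_symm_eventuallyEq hV))

/-- The vector field with constant value `u` in the preferred chart at `x`. -/
def coordField (x : X) (u : Model n) : Π z : X, TangentSpace (𝓡 n) z :=
  fun z => chartInvDeriv x (extChartAt (𝓡 n) x z) u

theorem coordField_self (x : X) (u : Model n) : coordField x u x = u := by
  rw [coordField, chartInvDeriv_self]
  rfl

theorem diffVFAt_coordField (x : X) (u : Model n) : DiffVFAt (coordField x u) x := by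
  let e := trivializationAt (Model n) (TangentSpace (𝓡 n)) x
  refine ContMDiffAt.mdifferentiableAt (n := ∞) ?_ (by simp)
  rw [e.contMDiffAt_section_iff (FiberBundle.mem_baseSet_trivializationAt' x)]
  refine (contMDiffAt_const (c := u)).congr_of_eventuallyEq ?_
  filter_upwards [(chartAt (Model n) x).open_source.mem_nhds (mem_chart_source _ x)] with z hz
  have hze : z ∈ e.baseSet := by simpa [e] using hz
  have coordField_eq_symmL : coordField x u z = e.symmL ℝ z u := by
    rw [TangentBundle.symmL_trivializationAt (I := 𝓡 n) hz, coordField,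
      chartInvDeriv_eq_mfderivWithin]
    rfl
  have h := e.continuousLinearMapAt_symmL (R := ℝ) hze u
  rw [Bundle.Trivialization.continuousLinearMapAt_apply, Bundle.Trivialization.linearMapAt_apply,
    if_pos hze] at h
  rwa [coordField_eq_symmL]

theorem endField_coordField_eventually (c : EndField n X) (x : X) (u : Model n) :
    ∀ᶠ y in nhds (extChartAt (𝓡 n) x x),
      (fun z => c z (coordField x u z)) ((extChartAt (𝓡 n) x).symm y) =
        chartInvDeriv x y (chartEnd c x y u) := by
  filter_upwards [extChartAt_target_mem_nhds x] with y hy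
  beta_reduce
  rw [coordField, (extChartAt (𝓡 n) x).right_inv hy]
  exact (congrArg (· u) (chartInvDeriv_comp_chartEnd c hy)).symm

theorem fderiv_chartEnd_apply (c : EndField n X) (x : X) (u w : Model n) :
    fderiv ℝ (fun y => chartEnd c x y u) (extChartAt (𝓡 n) x x) w = chartEndDeriv c x w u := by
  rw [fderiv_clm_apply (differentiableAt_chartEnd c x) (differentiableAt_const u)]
  simp [chartEndDeriv]

theorem mlieBracket_endField_coordField (a b : EndField n X) (x : X) (u v : Model n) :
    mlieBracket (𝓡 n) (fun z => a z (coordField x u z)) (fun z => b z (coordField x v z)) x =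
      chartEndDeriv b x (a.val x u) v - chartEndDeriv a x (b.val x v) u := by
  rw [mlieBracket_eq_lieBracket (endField_coordField_eventually a x u)
    (endField_coordField_eventually b x v), lieBracket, fderiv_chartEnd_apply,
    fderiv_chartEnd_apply, chartEnd_self, chartEnd_self]

theorem nijenhuisVal_apply (a b : EndField n X) (x : X) (u v : Model n) :
    nijenhuisVal a b x u v =
      commutatorTensor (a.val x) (b.val x) (chartEndDeriv a x) (chartEndDeriv b x) u v -
      commutatorTensor (a.val x) (b.val x) (chartEndDeriv a x) (chartEndDeriv b x) v u := by
  have h := nijenhuis_apply a b (diffVFAt_coordField x u) (diffVFAt_coordField x v)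
  rw [coordField_self, coordField_self] at h
  have bracket (c d : EndField n X) (u v : Model n) := mlieBracket_endField_coordField c d x u v
  have bracket_left (c : EndField n X) (u v : Model n) : mlieBracket (𝓡 n)
      (fun z => c z (coordField x u z)) (coordField x v) x = -chartEndDeriv c x v u := by
    refine (bracket c 1 u v).trans ?_
    rw [chartEndDeriv_one]
    exact zero_sub _
  have bracket_coordField : mlieBracket (𝓡 n) (coordField x u) (coordField x v) x =
      (0 : Model n) := by
    refine (bracket_left 1 u v).trans ?_
    rw [chartEndDeriv_one]
    exact neg_zero
  refine h.trans ?_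
  simp only [nijenhuisField, Pi.add_apply, Pi.sub_apply]
  rw [bracket_coordField, bracket, bracket, bracket_left, bracket_left, bracket_left,
    bracket_left]
  simp only [commutatorTensor_apply]
  change a.val x (b.val x 0) + b.val x (a.val x 0) + (_ - _ : Model n) - (_ - _ : Model n) -
    a.val x (-_) + a.val x (-_) - b.val x (-_) + b.val x (-_) = _
  simp only [map_neg, map_zero]
  abel

theorem insertNijenhuis_apply (a b : EndField n X) (η : FormField n X p) (x : X) :
    insertNijenhuis a b η x = wedgeAction (η x)
      (commutatorTensor (a.val x) (b.val x) (chartEndDeriv a x) (chartEndDeriv b x)) := by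
  rw [← insertTwoForm_sub_flip, insertNijenhuis]
  congr 1
  ext u v : 2
  exact nijenhuisVal_apply a b x u v

theorem rhoHat_lieOp_commutator (a b : EndField n X) {η : FormField n X p}
    (hη : IsSmoothForm η) :
    rhoHat a (lieOp b η) - lieOp b (rhoHat a η) = lieOp (b * a) η - insertNijenhuis a b η := by
  funext x
  have h := infAction_lieJet_commutator (a.val x) (b.val x) (chartEndDeriv a x)
    (chartEndDeriv b x) (η x) (chartFormDeriv η x)
  rw [← chartFormDeriv_rhoHat a hη, ← lieOp_apply b hη] at h
  rwa [Pi.sub_apply, Pi.sub_apply, lieOp_apply b (hη.rhoHat a), lieOp_apply (b * a) hη,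
    insertNijenhuis_apply, chartEndDeriv_mul, add_comm (_ ∘L _)]

end Commutators

section RightAction
variable {E W U : Type*} [NormedAddCommGroup E] [NormedSpace ℝ E] [NormedAddCommGroup W]
  [NormedSpace ℝ W] [NormedRing U] [NormedAlgebra ℝ U]

theorem exists_localInverse [FiniteDimensional ℝ E] [FiniteDimensional ℝ W] {F : E → W}
    (hF : ContDiff ℝ 1 F) {q : E} (hbij : Function.Bijective (fderiv ℝ F q)) :
    ∃ G : W → E, G (F q) = q ∧ ContinuousAt G (F q) ∧ ∀ᶠ w in nhds (F q),
      DifferentiableAt ℝ G w ∧ F (G w) = w ∧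
        fderiv ℝ G w ∘L fderiv ℝ F (G w) = ContinuousLinearMap.id ℝ E := by
  have : CompleteSpace E := FiniteDimensional.complete ℝ E
  let F' : E ≃L[ℝ] W :=
    (LinearEquiv.ofBijective (fderiv ℝ F q).toLinearMap hbij).toContinuousLinearEquiv
  have hFd := hF.differentiable one_ne_zero
  have hF' : HasFDerivAt F (F' : E →L[ℝ] W) q := (hFd q).hasFDerivAt
  have hstrict := hF.contDiffAt.hasStrictFDerivAt' hF' one_ne_zero
  obtain ⟨G, hGq, hG, hleft, hright⟩ : ∃ G : W → E, G (F q) = q ∧ ContDiffAt ℝ 1 G (F q) ∧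
      (∀ᶠ z in nhds q, ∀ᶠ z' in nhds z, G (F z') = z') ∧ ∀ᶠ w in nhds (F q), F (G w) = w :=
    ⟨_, hstrict.localInverse_apply_image, hF.contDiffAt.to_localInverse hF' one_ne_zero,
      hstrict.eventually_left_inverse.eventually_nhds, hstrict.eventually_right_inverse⟩
  refine ⟨G, hGq, hG.continuousAt, ?_⟩
  filter_upwards [hG.continuousAt.eventually (hGq.symm ▸ hleft), hG.eventually (by simp), hright]
    with w hGF hGw hFG
  have hd := hGw.differentiableAt one_ne_zero
  refine ⟨hd, hFG, ?_⟩
  rw [← hFG] at hd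
  have hcomp := hd.hasFDerivAt.comp _ (hFd _).hasFDerivAt
  rw [hFG] at hcomp
  exact (hcomp.congr_of_eventuallyEq (hGF.mono fun z hz => hz.symm)).unique (hasFDerivAt_id _)

theorem bijective_add_of_isCompl {K M N : Type*} [Field K] [AddCommGroup M] [Module K M]
    [AddCommGroup N] [Module K N] (A : M →ₗ[K] N) {C : Submodule K M} {S : Submodule K N}
    (hC : IsCompl C (LinearMap.ker A)) (hS : IsCompl (LinearMap.range A) S) :
    Function.Bijective fun q : C × S => A q.1 + (q.2 : N) :=
  (((LinearMap.kerComplementEquivRange A hC).prodCongr (LinearEquiv.refl K S)).trans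
    (Submodule.prodEquivOfIsCompl _ _ hS)).bijective

theorem countable_image_of_fderiv_eq_zero [SecondCountableTopology E] {f : E → W} {Ω : Set E}
    (hΩ : IsOpen Ω) (hf : DifferentiableOn ℝ f Ω) (hf' : ∀ z ∈ Ω, fderiv ℝ f z = 0) :
    (f '' Ω).Countable := by
  have hloc (u) (hu : u ∈ Ω) : ∃ B ∈ nhdsWithin u Ω, ∀ v ∈ B, f v = f u := by
    obtain ⟨ε, hε, hB⟩ := Metric.isOpen_iff.1 hΩ u hu
    refine ⟨Metric.ball u ε, mem_nhdsWithin_of_mem_nhds (Metric.ball_mem_nhds u hε), fun v hv => ?_⟩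
    exact Metric.isOpen_ball.is_const_of_fderiv_eq_zero (convex_ball u ε).isPreconnected
      (hf.mono hB) (fun z hz => hf' z (hB hz)) hv (Metric.mem_ball_self hε)
  choose! B hB hconst using hloc
  obtain ⟨t, ht, htc, hcov⟩ := TopologicalSpace.countable_cover_nhdsWithin hB
  refine (htc.image f).mono ?_
  rintro _ ⟨u, hu, rfl⟩
  obtain ⟨v, hv, huv⟩ := Set.mem_iUnion₂.1 (hcov hu)
  exact ⟨v, hv, (hconst v (ht hv) u huv).symm⟩

/-- A `C¹` right action of the units of a normed algebra `U` on a normed space `W`, given by a map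
defined on all of `U × W`. -/
structure IsC1RightAction (act : U → W → W) : Prop where
  contDiff : ContDiff ℝ 1 (Function.uncurry act)
  one : ∀ w, act 1 w = w
  mul : ∀ u v w, act (u * v) w = act v (act u w)

/-- The orbit of `w` under the units of `U`. -/
def unitOrbit (act : U → W → W) (w : W) : Set W := Set.range fun u : Uˣ => act u w

/-- The infinitesimal action `ξ ↦ d/ds act (1 + s ξ) w` at `w`, whose range is the tangent space at
`w` to the orbit of `w`. -/
def orbitDeriv (act : U → W → W) (w : W) : U →L[ℝ] W := fderiv ℝ (fun u => act u w) 1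

/-- The map parametrizing a neighbourhood of `w₀` by directions `m` along the orbit of `w₀` and a
slice `w₀ + S`; it is a chart if `m` is complementary to the kernel and `S` to the range of
`orbitDeriv act w₀`. -/
def sliceMap (act : U → W → W) (w₀ : W) (m : Submodule ℝ U) (S : Submodule ℝ W) (q : m × S) : W :=
  act (1 + q.1) (w₀ + q.2)

namespace IsC1RightAction
variable {act : U → W → W} (hact : IsC1RightAction act)
include hact

theorem hasFDerivAt (u : U) (w : W) : HasFDerivAt (Function.uncurry act)
    (fderiv ℝ (Function.uncurry act) (u, w)) (u, w) :=
  (hact.contDiff.differentiable one_ne_zero _).hasFDerivAt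

theorem differentiable_left (w : W) : Differentiable ℝ fun u => act u w :=
  (hact.contDiff.differentiable one_ne_zero).comp (by fun_prop : Differentiable ℝ (·, w))

theorem differentiable_right (u : U) : Differentiable ℝ (act u) :=
  (hact.contDiff.differentiable one_ne_zero).comp (by fun_prop : Differentiable ℝ (u, ·))

theorem fderiv_uncurry_inl (u : U) (w : W) (ξ : U) :
    fderiv ℝ (Function.uncurry act) (u, w) (ξ, 0) = fderiv ℝ (fun v => act v w) u ξ :=
  congrArg (fun f : U →L[ℝ] W => f ξ)
    ((hact.hasFDerivAt u w).comp (f := fun v => (v, w)) u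
      (hasFDerivAt_prodMk_left u w)).fderiv.symm

theorem fderiv_uncurry_one (w : W) (ξ : U) (ψ : W) :
    fderiv ℝ (Function.uncurry act) (1, w) (ξ, ψ) = orbitDeriv act w ξ + ψ := by
  have hinr : fderiv ℝ (Function.uncurry act) (1, w) (0, ψ) = ψ := by
    have h := ((hact.hasFDerivAt 1 w).comp w (hasFDerivAt_prodMk_right 1 w)).congr_of_eventuallyEq
      (.of_forall fun v => (hact.one v).symm : id =ᶠ[nhds w] _)
    exact congrArg (· ψ) (h.unique (hasFDerivAt_id w))
  rw [← Prod.fst_add_snd (ξ, ψ), map_add, hinr, hact.fderiv_uncurry_inl, orbitDeriv]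

theorem fderiv_left_mul (u : U) (w : W) (ζ : U) :
    fderiv ℝ (fun v => act v w) u (u * ζ) = orbitDeriv act (act u w) ζ := by
  have hu : HasFDerivAt (fun v => act v w) (fderiv ℝ (fun v => act v w) u) (u * 1) := by
    rw [mul_one]
    exact (hact.differentiable_left w u).hasFDerivAt
  have h := hu.comp 1 (ContinuousLinearMap.mul ℝ U u).hasFDerivAt
  exact congrArg (· ζ) (h.congr_of_eventuallyEq
    (.of_forall fun v => (hact.mul u v w).symm)).fderiv.symm

theorem fderiv_right_orbitDeriv (u : Uˣ) (w : W) (η : U) :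
    fderiv ℝ (act u) w (orbitDeriv act w η) = orbitDeriv act (act u w) (↑u⁻¹ * η * u) := by
  have hright : HasFDerivAt (fun v => act u (act v w))
      (fderiv ℝ (act u) w ∘L orbitDeriv act w) 1 := by
    have h := (hact.differentiable_right u (act 1 w)).hasFDerivAt.comp 1
      (hact.differentiable_left w 1).hasFDerivAt
    rwa [hact.one w] at h
  have hleft : HasFDerivAt (fun v => act (v * u) w)
      (fderiv ℝ (fun v => act v w) u ∘L (ContinuousLinearMap.mul ℝ U).flip u) 1 := by
    have h := (hact.differentiable_left w (1 * u)).hasFDerivAt.comp 1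
      ((ContinuousLinearMap.mul ℝ U).flip u).hasFDerivAt
    rwa [one_mul] at h
  simp only [hact.mul] at hleft
  rw [← hact.fderiv_left_mul, ← mul_assoc, ← mul_assoc, u.mul_inv, one_mul]
  exact congrArg (fun f => f η) (hright.unique hleft)

theorem finrank_range_orbitDeriv_le [FiniteDimensional ℝ U] (u : Uˣ) (w : W) :
    Module.finrank ℝ (orbitDeriv act (act u w)).range ≤
      Module.finrank ℝ (orbitDeriv act w).range := by
  refine (Submodule.finrank_mono ?_).trans
    (Submodule.finrank_map_le (fderiv ℝ (act u) w).toLinearMap _)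
  rintro _ ⟨ζ, rfl⟩
  refine ⟨_, ⟨u * ζ * ↑u⁻¹, rfl⟩, (hact.fderiv_right_orbitDeriv u w _).trans ?_⟩
  simp [mul_assoc]

theorem countable_image_of_fderiv_comp_orbitDeriv_eq_zero [FiniteDimensional ℝ U] {c : W → E}
    {w₀ : W} {O : Set W} (hO : IsOpen O) (hc : DifferentiableOn ℝ c O)
    (hc' : ∀ w ∈ O ∩ unitOrbit act w₀, fderiv ℝ c w ∘L orbitDeriv act w = 0) :
    (c '' (O ∩ unitOrbit act w₀)).Countable := by
  have : CompleteSpace U := FiniteDimensional.complete ℝ U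
  have : ProperSpace U := FiniteDimensional.proper ℝ U
  let Ω : Set U := {u | IsUnit u ∧ act u w₀ ∈ O}
  have hΩ : IsOpen Ω :=
    Units.isOpen.inter (hO.preimage (hact.differentiable_left w₀).continuous)
  have hd (u) (hu : u ∈ Ω) : HasFDerivAt (fun u => c (act u w₀))
      (fderiv ℝ c (act u w₀) ∘L fderiv ℝ (fun v => act v w₀) u) u :=
    (hc.differentiableAt (hO.mem_nhds hu.2)).hasFDerivAt.comp u
      (hact.differentiable_left w₀ u).hasFDerivAt
  refine (countable_image_of_fderiv_eq_zero hΩ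
    (fun u hu => (hd u hu).differentiableAt.differentiableWithinAt) fun u hu => ?_).mono ?_
  · obtain ⟨⟨u, rfl⟩, huO⟩ := hu
    rw [(hd u ⟨u.isUnit, huO⟩).fderiv]
    ext ξ
    have h := hact.fderiv_left_mul u w₀ (↑u⁻¹ * ξ)
    rw [u.mul_inv_cancel_left] at h
    exact (congrArg _ h).trans (congrArg (fun f => f (↑u⁻¹ * ξ)) (hc' _ ⟨huO, u, rfl⟩))
  · rintro _ ⟨_, ⟨hwO, u, rfl⟩, rfl⟩
    exact ⟨u, ⟨u.isUnit, hwO⟩, rfl⟩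

section Slice
variable {w₀ : W} {m : Submodule ℝ U} {S : Submodule ℝ W}

theorem hasFDerivAt_sliceMap (q : m × S) : HasFDerivAt (sliceMap act w₀ m S)
    (fderiv ℝ (Function.uncurry act) (1 + q.1, w₀ + q.2) ∘L m.subtypeL.prodMap S.subtypeL) q :=
  (hact.hasFDerivAt _ _).comp (f := fun q : m × S => ((1 + q.1, w₀ + q.2) : U × W)) q
    ((m.subtypeL.prodMap S.subtypeL).hasFDerivAt.const_add (1, w₀))

theorem contDiff_sliceMap : ContDiff ℝ 1 (sliceMap act w₀ m S) :=
  hact.contDiff.comp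
    ((contDiff_const (c := ((1 : U), w₀))).add (m.subtypeL.prodMap S.subtypeL).contDiff)

theorem sliceMap_zero : sliceMap act w₀ m S 0 = w₀ := by simp [sliceMap, hact.one]

theorem fderiv_sliceMap_zero (q : m × S) :
    fderiv ℝ (sliceMap act w₀ m S) 0 q = orbitDeriv act w₀ q.1 + q.2 := by
  rw [(hact.hasFDerivAt_sliceMap 0).fderiv, ← hact.fderiv_uncurry_one w₀ q.1 q.2]
  simp [Prod.map]

theorem bijective_fderiv_sliceMap_zero (hm : IsCompl m (orbitDeriv act w₀).ker)
    (hS : IsCompl (orbitDeriv act w₀).range S) :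
    Function.Bijective (fderiv ℝ (sliceMap act w₀ m S) 0) := by
  convert bijective_add_of_isCompl (orbitDeriv act w₀).toLinearMap hm hS
  exact hact.fderiv_sliceMap_zero _

theorem fderiv_sliceMap_inl_mem_range {q : m × S} (hq : IsUnit (1 + q.1 : U)) (ξ : m) :
    fderiv ℝ (sliceMap act w₀ m S) q (ξ, 0) ∈ (orbitDeriv act (sliceMap act w₀ m S q)).range := by
  obtain ⟨u, hu⟩ := hq
  refine ⟨↑u⁻¹ * ξ, (hact.fderiv_left_mul _ _ _).symm.trans ?_⟩
  rw [(hact.hasFDerivAt_sliceMap q).fderiv, ← hu, u.mul_inv_cancel_left,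
    ← hact.fderiv_uncurry_inl]
  simp

theorem range_orbitDeriv_sliceMap [FiniteDimensional ℝ U] [FiniteDimensional ℝ W] {q : m × S}
    (hm : IsCompl m (orbitDeriv act w₀).ker) (hq : IsUnit (1 + q.1 : U))
    (horb : sliceMap act w₀ m S q ∈ unitOrbit act w₀)
    (hinj : Function.Injective (fderiv ℝ (sliceMap act w₀ m S) q)) :
    (orbitDeriv act (sliceMap act w₀ m S q)).range =
      (fderiv ℝ (sliceMap act w₀ m S) q ∘L ContinuousLinearMap.inl ℝ m S).range := by
  refine (Submodule.eq_of_le_of_finrank_le ?_ ?_).symm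
  · rintro _ ⟨ξ, rfl⟩
    exact hact.fderiv_sliceMap_inl_mem_range hq ξ
  · obtain ⟨u, hu⟩ := horb
    have hinj' : Function.Injective
        (fderiv ℝ (sliceMap act w₀ m S) q ∘L ContinuousLinearMap.inl ℝ m S).toLinearMap :=
      hinj.comp (Prod.mk_left_injective 0)
    rw [LinearMap.finrank_range_of_inj hinj', ← hu,
      (LinearMap.kerComplementEquivRange _ hm).finrank_eq]
    exact hact.finrank_range_orbitDeriv_le u w₀

end Slice

/- By the inverse function theorem `sliceMap` is a chart near `w₀`; the slice coordinate `s` in this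
chart is the required map. -/
theorem exists_transversal [FiniteDimensional ℝ U] [FiniteDimensional ℝ W] (w₀ : W) :
    ∃ (S : Submodule ℝ W) (c : W → S),
      (∀ᶠ w in nhds w₀, DifferentiableAt ℝ c w ∧
        (w ∈ unitOrbit act w₀ → fderiv ℝ c w ∘L orbitDeriv act w = 0)) ∧
      (fderiv ℝ c w₀).ker ≤ (orbitDeriv act w₀).range := by
  have : CompleteSpace U := FiniteDimensional.complete ℝ U
  obtain ⟨m, hm⟩ := Submodule.exists_isCompl (orbitDeriv act w₀).ker
  obtain ⟨S, hS⟩ := Submodule.exists_isCompl (orbitDeriv act w₀).range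
  have hbij := hact.bijective_fderiv_sliceMap_zero hm.symm hS
  obtain ⟨G, hG0, hGc, hG⟩ := exists_localInverse hact.contDiff_sliceMap hbij
  rw [hact.sliceMap_zero] at hG0 hGc hG
  have hunit : ∀ᶠ w in nhds w₀, IsUnit (1 + (G w).1 : U) := by
    refine ContinuousAt.eventually_mem (f := fun w => (1 + (G w).1 : U)) (by fun_prop)
      (Units.isOpen.mem_nhds (?_ : IsUnit (1 + (G w₀).1 : U)))
    simp [hG0]
  have hc {w} (hd : DifferentiableAt ℝ G w) :
      fderiv ℝ (fun w => (G w).2) w = ContinuousLinearMap.snd ℝ m S ∘L fderiv ℝ G w :=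
    hd.hasFDerivAt.snd.fderiv
  refine ⟨S, fun w => (G w).2, ?_, fun ψ hψ => ?_⟩
  · filter_upwards [hG, hunit] with w ⟨hd, hw, hinv⟩ hu
    refine ⟨hd.snd, fun horb => ?_⟩
    have hrange := hact.range_orbitDeriv_sliceMap hm.symm hu (hw.symm ▸ horb)
      (Function.LeftInverse.injective fun q => congrArg (fun f => f q) hinv)
    rw [hw] at hrange
    ext ζ : 1
    obtain ⟨ξ, hξ⟩ := hrange.le ⟨ζ, rfl⟩
    rw [hc hd, ContinuousLinearMap.comp_apply, ← ContinuousLinearMap.coe_coe (orbitDeriv act w),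
      ← hξ]
    exact congrArg (fun f => (f (ξ, 0)).2) hinv
  · obtain ⟨hd, -, hinv⟩ := hG.self_of_nhds
    obtain ⟨q, rfl⟩ := hbij.2 ψ
    have hq : q.2 = 0 := by
      rw [LinearMap.mem_ker, ContinuousLinearMap.coe_coe, hc hd] at hψ
      rw [hG0] at hinv
      exact (congrArg (fun f => (f q).2) hinv).symm.trans hψ
    refine ⟨q.1, ?_⟩
    rw [hact.fderiv_sliceMap_zero, hq]
    simp

/- In the slice coordinate `c`, the map is constant: `c` takes only countably many values on the
orbit. -/
theorem range_fderiv_le_range_orbitDeriv [FiniteDimensional ℝ U] [FiniteDimensional ℝ W]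
    {γ : E → W} {y₀ : E} (hd : DifferentiableAt ℝ γ y₀)
    (hγ : ∀ᶠ y in nhds y₀, ContinuousAt γ y)
    (horb : ∀ᶠ y in nhds y₀, γ y ∈ unitOrbit act (γ y₀)) :
    (fderiv ℝ γ y₀).range ≤ (orbitDeriv act (γ y₀)).range := by
  obtain ⟨S, c, hc, hker⟩ := hact.exists_transversal (γ y₀)
  obtain ⟨O, hOc, hO, hOm⟩ := eventually_nhds_iff.1 hc
  have hmem : ∀ᶠ y in nhds y₀, γ y ∈ O := hd.continuousAt.eventually (hO.mem_nhds hOm)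
  obtain ⟨ε, hε, hball⟩ := Metric.eventually_nhds_iff_ball.1 (hγ.and (hmem.and horb))
  have hcount : ((c ∘ γ) '' Metric.ball y₀ ε).Countable := by
    refine (hact.countable_image_of_fderiv_comp_orbitDeriv_eq_zero (w₀ := γ y₀) hO
      (fun w hw => (hOc w hw).1.differentiableWithinAt) fun w hw => (hOc w hw.1).2 hw.2).mono ?_
    rw [Set.image_comp]
    exact Set.image_mono (Set.image_subset_iff.2 fun y hy => (hball y hy).2)
  have hconn : IsPreconnected ((c ∘ γ) '' Metric.ball y₀ ε) :=
    (convex_ball y₀ ε).isPreconnected.image _ fun y hy =>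
      ((hOc _ (hball y hy).2.1).1.continuousAt.comp (hball y hy).1).continuousWithinAt
  have hconst : (c ∘ γ) =ᶠ[nhds y₀] fun _ => c (γ y₀) := by
    filter_upwards [Metric.ball_mem_nhds y₀ hε] with y hy
    exact hcount.isTotallyDisconnected _ subset_rfl hconn ⟨y, hy, rfl⟩
      ⟨y₀, Metric.mem_ball_self hε, rfl⟩
  have hzero := ((hOc _ hOm).1.hasFDerivAt.comp y₀ hd.hasFDerivAt).unique
    ((hasFDerivAt_const _ y₀).congr_of_eventuallyEq hconst)
  rintro _ ⟨v, rfl⟩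
  exact hker (congrArg (fun f : E →L[ℝ] S => f v) hzero)

end IsC1RightAction
end RightAction

section FormTuple
open ContinuousAlternatingMap (toContinuousMultilinearMapLI)
variable {E : Type*} [NormedAddCommGroup E] [NormedSpace ℝ E] {l : ℕ} {p : Fin l → ℕ}

/-- Tuples of alternating forms of degrees `p`. -/
abbrev FormTuple (E : Type*) [NormedAddCommGroup E] [NormedSpace ℝ E] {l : ℕ} (p : Fin l → ℕ) :
    Type _ := ∀ i, E [⋀^Fin (p i)]→L[ℝ] ℝ

/-- The pull-back of a tuple of forms by an endomorphism. -/
def pullTuple (g : E →L[ℝ] E) (Φ : FormTuple E p) : FormTuple E p :=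
  fun i => (Φ i).compContinuousLinearMap g

instance finiteDimensional_continuousMultilinearMap [FiniteDimensional ℝ E] (q : ℕ) :
    FiniteDimensional ℝ (ContinuousMultilinearMap ℝ (fun _ : Fin q => E) ℝ) :=
  Module.Finite.of_injective
    (ContinuousMultilinearMap.toMultilinearMapLinear (R' := ℝ) (A := ℝ) (M₁ := fun _ : Fin q => E)
      (M₂ := ℝ)) ContinuousMultilinearMap.toMultilinearMap_injective

instance finiteDimensional_continuousAlternatingMap [FiniteDimensional ℝ E] (q : ℕ) :
    FiniteDimensional ℝ (E [⋀^Fin q]→L[ℝ] ℝ) :=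
  Module.Finite.of_injective
    (toContinuousMultilinearMapLI (𝕜 := ℝ) (E := E) (F := ℝ) (ι := Fin q)).toLinearMap
    (toContinuousMultilinearMapLI (𝕜 := ℝ) (E := E) (F := ℝ) (ι := Fin q)).injective

/- In finite dimensions alternating forms are a retract of multilinear forms, where the pull-back is
known to be smooth. -/
theorem contDiff_uncurry_pullTuple [FiniteDimensional ℝ E] :
    ContDiff ℝ 1 (Function.uncurry (pullTuple (E := E) (p := p))) := by
  refine contDiff_pi.2 fun i => ?_
  let J := (toContinuousMultilinearMapLI (𝕜 := ℝ) (E := E) (F := ℝ) (ι := Fin (p i)))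
  obtain ⟨K, hK⟩ := LinearMap.exists_leftInverse_of_injective J.toLinearMap
    (LinearMap.ker_eq_bot.2 J.injective)
  have hmultilinear : ContDiff ℝ 1 fun q : (E →L[ℝ] E) × FormTuple E p =>
      ContinuousMultilinearMap.compContinuousLinearMapContinuousMultilinear ℝ
        (fun _ : Fin (p i) => E) (fun _ => E) ℝ (fun _ => q.1) (J (q.2 i)) := by
    refine ContDiff.clm_apply ?_ ?_
    · exact (ContinuousMultilinearMap.contDiff _).comp (contDiff_pi.2 fun _ => contDiff_fst)
    · exact J.toContinuousLinearMap.contDiff.comp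
        ((ContinuousLinearMap.proj i : FormTuple E p →L[ℝ] _).contDiff.comp contDiff_snd)
  convert K.toContinuousLinearMap.contDiff.comp hmultilinear using 1
  funext q
  exact (congrArg (fun f => f (pullTuple q.1 q.2 i)) hK).symm

theorem isC1RightAction_pullTuple [FiniteDimensional ℝ E] :
    IsC1RightAction (pullTuple (E := E) (p := p)) where
  contDiff := contDiff_uncurry_pullTuple
  one _ := rfl
  mul _ _ _ := rfl

theorem orbitDeriv_pullTuple_apply (Φ : FormTuple E p) (ξ : E →L[ℝ] E) (i : Fin l) :
    orbitDeriv pullTuple Φ ξ i = infAction ξ (Φ i) := by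
  have h : HasFDerivAt (fun g => pullTuple g Φ)
      (ContinuousLinearMap.pi fun i => infActionCLM E (p i) (Φ i)) 1 := by
    refine hasFDerivAt_pi.2 fun i => ?_
    have h := HasFDerivAt.continuousAlternatingMapCompContinuousLinearMap
      (hasFDerivAt_const (Φ i) (1 : E →L[ℝ] E)) (hasFDerivAt_id (1 : E →L[ℝ] E))
    exact h.congr_fderiv (ContinuousLinearMap.ext fun ξ => zero_add (infAction ξ (Φ i)))
  rw [orbitDeriv, h.fderiv]
  rfl

end FormTuple

section OrbitSection
open ContinuousAlternatingMap (compContinuousLinearMap_apply)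
variable {n : ℕ} {X : Type*} [TopologicalSpace X] [ChartedSpace (Model n) X]
  [IsManifold (𝓡 n) ∞ X] {V : Type*} [NormedAddCommGroup V] [NormedSpace ℝ V] {l : ℕ}
  {p : Fin l → ℕ} {ΦV : FormTuple V p} {Φ : ∀ i, FormField n X (p i)}

namespace IsOrbitSection

theorem exists_chartForm_eq (hΦ : IsOrbitSection ΦV Φ) {x₀ : X} {y : Model n}
    (hy : y ∈ (extChartAt (𝓡 n) x₀).target) :
    ∃ T : Model n ≃L[ℝ] V, ∀ i, chartForm (Φ i) x₀ y =
      (ΦV i).compContinuousLinearMap (T : Model n →L[ℝ] V) := by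
  obtain ⟨h, g, hg⟩ := hΦ.2 ((extChartAt (𝓡 n) x₀).symm y)
  let T₀ : Model n ≃L[ℝ] Model n := ContinuousLinearEquiv.equivOfInverse' (chartInvDeriv x₀ y)
    (chartDerivAt x₀ ((extChartAt (𝓡 n) x₀).symm y)) (chartInvDeriv_comp_chartDerivAt hy)
    (chartDerivAt_comp_chartInvDeriv hy)
  refine ⟨(T₀.trans h).trans g, fun i => ?_⟩
  ext u
  have hi := congrArg (fun f => f fun j => h (chartInvDeriv x₀ y (u j))) (congrFun hg i)
  simp only [compContinuousLinearMap_apply, Function.comp_def, ContinuousLinearEquiv.coe_coe,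
    ContinuousLinearEquiv.symm_apply_apply] at hi
  exact hi

theorem chartForm_mem_unitOrbit (hΦ : IsOrbitSection ΦV Φ) {x₀ : X} {y y' : Model n}
    (hy : y ∈ (extChartAt (𝓡 n) x₀).target) (hy' : y' ∈ (extChartAt (𝓡 n) x₀).target) :
    (fun i => chartForm (Φ i) x₀ y') ∈ unitOrbit pullTuple fun i => chartForm (Φ i) x₀ y := by
  obtain ⟨T, hT⟩ := hΦ.exists_chartForm_eq hy
  obtain ⟨T', hT'⟩ := hΦ.exists_chartForm_eq hy'
  refine ⟨(ContinuousLinearEquiv.unitsEquiv ℝ (Model n)).symm (T'.trans T.symm), funext fun i => ?_⟩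
  change (chartForm (Φ i) x₀ y).compContinuousLinearMap _ = chartForm (Φ i) x₀ y'
  rw [hT i, hT' i]
  ext u
  exact congrArg (ΦV i) (funext fun j => T.apply_symm_apply (T' (u j)))

theorem exists_chartFormDeriv_apply_eq (hΦ : IsOrbitSection ΦV Φ) (x : X) (v : Model n) :
    ∃ ζ : Model n →L[ℝ] Model n, ∀ i, chartFormDeriv (Φ i) x v = infAction ζ (Φ i x) := by
  let γ : Model n → FormTuple (Model n) p := fun y i => chartForm (Φ i) x y
  have hd : HasFDerivAt γ (ContinuousLinearMap.pi fun i => chartFormDeriv (Φ i) x)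
      (extChartAt (𝓡 n) x x) :=
    hasFDerivAt_pi.2 fun i => ((hΦ.1 i).differentiableAt_chartForm x).hasFDerivAt
  have hcont : ∀ᶠ y in nhds (extChartAt (𝓡 n) x x), ContinuousAt γ y := by
    filter_upwards [extChartAt_target_mem_nhds x] with y hy
    exact continuousAt_pi.2 fun i => ((hΦ.1 i) x).continuousOn.continuousAt
      ((isOpen_extChartAt_target x).mem_nhds hy)
  have horb : ∀ᶠ y in nhds (extChartAt (𝓡 n) x x),
      γ y ∈ unitOrbit pullTuple (γ (extChartAt (𝓡 n) x x)) := by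
    filter_upwards [extChartAt_target_mem_nhds x] with y hy
    exact hΦ.chartForm_mem_unitOrbit (mem_extChartAt_target (I := 𝓡 n) x) hy
  obtain ⟨ζ, hζ⟩ := isC1RightAction_pullTuple.range_fderiv_le_range_orbitDeriv
    hd.differentiableAt hcont horb ⟨v, rfl⟩
  refine ⟨ζ, fun i => ?_⟩
  rw [hd.fderiv] at hζ
  rw [← chartForm_self (Φ i) x]
  exact (congrFun hζ i).symm.trans (orbitDeriv_pullTuple_apply _ ζ i)

theorem exists_chartFormDeriv_eq (hΦ : IsOrbitSection ΦV Φ) (x : X) :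
    ∃ C : Model n →L[ℝ] Model n →L[ℝ] Model n, ∀ i,
      chartFormDeriv (Φ i) x = infActionCLM (Model n) (p i) (Φ i x) ∘L C := by
  choose ζ hζ using hΦ.exists_chartFormDeriv_apply_eq x
  let e := Module.finBasis ℝ (Model n)
  let C := (e.constr ℝ fun j => ζ (e j)).toContinuousLinearMap
  refine ⟨C, fun i => ContinuousLinearMap.coe_injective (e.ext fun j => ?_)⟩
  have hC : C (e j) = ζ (e j) := e.constr_basis ℝ _ j
  change chartFormDeriv (Φ i) x (e j) = infAction (C (e j)) (Φ i x)
  rw [hC, hζ]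

theorem exists_lieOp_eq (hΦ : IsOrbitSection ΦV Φ) (b : EndField n X) (x : X) :
    ∃ M : Model n →L[ℝ] Model n →L[ℝ] Model n, ∀ i, lieOp b (Φ i) x = wedgeAction (Φ i x) M := by
  obtain ⟨C, hC⟩ := hΦ.exists_chartFormDeriv_eq x
  refine ⟨C ∘L b.val x - chartEndDeriv b x, fun i => ?_⟩
  rw [lieOp_apply b (hΦ.1 i), hC i, lieJet_infActionCLM_comp]

end IsOrbitSection
end OrbitSection

section AdicSum

open Finset.HasAntidiagonal (antidiagonal antidiagonal.fst_le antidiagonal.snd_le)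
open PowerSeries (coeff)

variable {R : Type*} [Semiring R]

/-- The `t`-adic sum `∑ F_m` of power series with `m ≤ (F m).order`, so that only `F 0, …, F k`
contribute to the coefficient of `t^k`. -/
def adicSum (F : ℕ → PowerSeries R) : PowerSeries R :=
  PowerSeries.mk fun k => ∑ m ∈ Finset.range (k + 1), coeff k (F m)

theorem coeff_adicSum (F : ℕ → PowerSeries R) (k : ℕ) :
    coeff k (adicSum F) = ∑ m ∈ Finset.range (k + 1), coeff k (F m) :=
  PowerSeries.coeff_mk _ _

theorem coeff_adicSum_of_le {F : ℕ → PowerSeries R} (hF : ∀ m : ℕ, (m : ℕ∞) ≤ (F m).order)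
    {k K : ℕ} (hk : k ≤ K) :
    coeff k (adicSum F) = ∑ m ∈ Finset.range (K + 1), coeff k (F m) := by
  rw [coeff_adicSum]
  refine Finset.sum_subset (Finset.range_mono (by lia)) fun m _ hm => ?_
  have hkm : k < m := by simpa using hm
  exact PowerSeries.coeff_of_lt_order _ ((Nat.cast_lt.2 hkm).trans_le (hF m))

theorem mul_adicSum (D : PowerSeries R) {F : ℕ → PowerSeries R}
    (hF : ∀ m : ℕ, (m : ℕ∞) ≤ (F m).order) : D * adicSum F = adicSum fun m => D * F m := by
  ext k
  simp only [coeff_adicSum _ k, PowerSeries.coeff_mul]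
  rw [Finset.sum_comm]
  refine Finset.sum_congr rfl fun ij hij => ?_
  rw [coeff_adicSum_of_le hF (antidiagonal.snd_le hij), Finset.mul_sum]

theorem adicSum_mul (D : PowerSeries R) {F : ℕ → PowerSeries R}
    (hF : ∀ m : ℕ, (m : ℕ∞) ≤ (F m).order) : adicSum F * D = adicSum fun m => F m * D := by
  ext k
  simp only [coeff_adicSum _ k, PowerSeries.coeff_mul]
  rw [Finset.sum_comm]
  refine Finset.sum_congr rfl fun ij hij => ?_
  rw [coeff_adicSum_of_le hF (antidiagonal.fst_le hij), Finset.sum_mul]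

theorem adicSum_mul_adicSum {F G : ℕ → PowerSeries R} (hF : ∀ m : ℕ, (m : ℕ∞) ≤ (F m).order)
    (hG : ∀ m : ℕ, (m : ℕ∞) ≤ (G m).order) :
    adicSum F * adicSum G = adicSum fun m => ∑ ij ∈ antidiagonal m, F ij.1 * G ij.2 := by
  ext k
  rw [adicSum_mul _ hF, coeff_adicSum, coeff_adicSum]
  simp only [mul_adicSum _ hG, coeff_adicSum, map_sum,
    Finset.Nat.sum_antidiagonal_eq_sum_range_succ_mk]
  rw [Finset.sum_range_diag_flip (k + 1) fun i j => coeff k (F i * G j)]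
  refine Finset.sum_congr rfl fun i _ => (Finset.sum_subset (Finset.range_mono (by lia)) ?_).symm
  intro j _ hj
  have hkij : (k : ℕ∞) < i + j := by
    rw [Finset.mem_range] at hj
    exact_mod_cast (by lia : k < i + j)
  exact PowerSeries.coeff_of_lt_order _ <| hkij.trans_le <|
    (add_le_add (hF i) (hG j)).trans (PowerSeries.le_order_mul _ _)

end AdicSum

attribute [local instance] LieRing.ofAssociativeRing

section ExpSum

open Finset.HasAntidiagonal (antidiagonal mem_antidiagonal)
open PowerSeries (coeff)

variable {R : Type*} [Ring R] [Algebra ℝ R] {r : PowerSeries R}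

theorem order_le_order_real_smul (c : ℝ) (P : PowerSeries R) : P.order ≤ (c • P).order :=
  PowerSeries.le_order _ _ fun i hi => by
    rw [PowerSeries.coeff_smul, PowerSeries.coeff_of_lt_order i hi, smul_zero]

/-- `e^r = ∑ r^m / m!` for a power series `r` without constant term over a ring which need not
be commutative. -/
def expSum (r : PowerSeries R) : PowerSeries R :=
  adicSum fun m => (m.factorial : ℝ)⁻¹ • r ^ m

theorem le_order_expSum_term (hr : r.constantCoeff = 0) (m : ℕ) :
    (m : ℕ∞) ≤ ((m.factorial : ℝ)⁻¹ • r ^ m).order :=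
  (PowerSeries.le_order_pow_of_constantCoeff_eq_zero m hr).trans (order_le_order_real_smul _ _)

theorem coeff_expSum (r : PowerSeries R) (k : ℕ) : coeff k (expSum r) =
    ∑ m ∈ Finset.range (k + 1), (m.factorial : ℝ)⁻¹ • coeff k (r ^ m) :=
  coeff_adicSum _ _

theorem coeff_expSum_apply {V : Type*} [AddCommGroup V] [Module ℝ V]
    (r : PowerSeries (Module.End ℝ V)) (k : ℕ) (v : V) : coeff k (expSum r) v =
      ∑ m ∈ Finset.range (k + 1), (m.factorial : ℝ)⁻¹ • coeff k (r ^ m) v := by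
  rw [coeff_expSum, LinearMap.sum_apply]
  rfl

theorem coeff_zero_expSum (r : PowerSeries R) : coeff 0 (expSum r) = 1 := by
  simp [coeff_expSum]

theorem expSum_zero : expSum (0 : PowerSeries R) = 1 := by
  ext k
  rw [coeff_expSum, Finset.sum_range_succ', Finset.sum_eq_zero fun m _ => by simp]
  simp

theorem constantCoeff_real_smul (hr : r.constantCoeff = 0) (s : ℝ) :
    (s • r).constantCoeff = 0 := by
  rw [← PowerSeries.coeff_zero_eq_constantCoeff_apply, PowerSeries.coeff_smul,
    PowerSeries.coeff_zero_eq_constantCoeff_apply, hr, smul_zero]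

theorem commute_expSum_smul (hr : r.constantCoeff = 0) (s : ℝ) : Commute r (expSum (s • r)) := by
  have hF := le_order_expSum_term (constantCoeff_real_smul hr s)
  rw [Commute, SemiconjBy, expSum, mul_adicSum _ hF, adicSum_mul _ hF]
  simp only [mul_smul_comm, smul_mul_assoc, smul_pow, (Commute.self_pow r _).eq]

/-- `e^{ad_r} D = ∑ ad_r^m D / m!` for a power series `r` without constant term. -/
def expAd (r D : PowerSeries R) : PowerSeries R :=
  adicSum fun m => (m.factorial : ℝ)⁻¹ • (LieAlgebra.ad ℝ (PowerSeries R) r ^ m) D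

theorem le_order_ad_pow (hr : r.constantCoeff = 0) (D : PowerSeries R) (m : ℕ) :
    (m : ℕ∞) ≤ ((LieAlgebra.ad ℝ (PowerSeries R) r ^ m) D).order := by
  induction m with
  | zero => simp
  | succ m ih =>
    have hr' : 1 ≤ r.order := PowerSeries.one_le_order_iff_constCoeff_eq_zero.2 hr
    rw [pow_succ', Module.End.mul_apply, LieAlgebra.ad_apply, Ring.lie_def, sub_eq_add_neg]
    refine le_trans (le_min ?_ ?_) (PowerSeries.min_order_le_order_add _ _)
    · rw [Nat.cast_succ, add_comm]
      exact (add_le_add hr' ih).trans (PowerSeries.le_order_mul _ _)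
    · rw [PowerSeries.order_neg]
      exact (add_le_add ih hr').trans (PowerSeries.le_order_mul _ _)

theorem ad_neg_pow_apply {S : Type*} [Ring S] [Algebra ℝ S] (r D : S) (m : ℕ) :
    (LieAlgebra.ad ℝ S (-r) ^ m) D = (-1 : ℝ) ^ m • (LieAlgebra.ad ℝ S r ^ m) D := by
  rw [map_neg, ← neg_one_smul ℝ, smul_pow, LinearMap.smul_apply]

theorem mul_pow_eq_sum_ad {S : Type*} [Ring S] [Algebra ℝ S] (r D : S) (m : ℕ) :
    D * r ^ m = ∑ ij ∈ antidiagonal m,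
      m.choose ij.1 • (r ^ ij.1 * (LieAlgebra.ad ℝ S (-r) ^ ij.2) D) := by
  have had : LieAlgebra.ad ℝ S (-r) = LinearMap.mulRight ℝ r - LinearMap.mulLeft ℝ r := by
    rw [map_neg, LieAlgebra.ad_eq_lmul_left_sub_lmul_right, Pi.sub_apply, neg_sub]
  have hcomm : Commute (LinearMap.mulLeft ℝ r) (LieAlgebra.ad ℝ S (-r)) := by
    rw [had]
    exact (LinearMap.commute_mulLeft_right r r).sub_right (Commute.refl _)
  have hbinomial := congrArg (fun f => f D) (hcomm.add_pow' m)
  rw [had, add_sub_cancel, LinearMap.pow_mulRight, ← had] at hbinomial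
  simpa [LinearMap.pow_mulLeft] using hbinomial

theorem mul_expSum (hr : r.constantCoeff = 0) (D : PowerSeries R) :
    D * expSum r = expSum r * expAd (-r) D := by
  have hr' : (-r).constantCoeff = 0 := by rw [map_neg, hr, neg_zero]
  rw [expSum, expAd, mul_adicSum _ (le_order_expSum_term hr), adicSum_mul_adicSum
    (le_order_expSum_term hr)
    fun m => (le_order_ad_pow hr' D m).trans (order_le_order_real_smul _ _)]
  congr 1 with m : 1
  rw [mul_smul_comm, mul_pow_eq_sum_ad, Finset.smul_sum]
  refine Finset.sum_congr rfl fun ij hij => ?_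
  obtain rfl := mem_antidiagonal.1 hij
  rw [smul_mul_smul_comm, ← Nat.cast_smul_eq_nsmul ℝ, smul_smul, Nat.cast_add_choose]
  congr 1
  have : ((ij.1 + ij.2).factorial : ℝ) ≠ 0 := Nat.cast_ne_zero.2 (Nat.factorial_ne_zero _)
  field_simp

theorem coeff_expAd_neg_smul {H : Type*} [AddCommGroup H] [Module R H]
    (hr : r.constantCoeff = 0) (d : R) (v : H) (k : ℕ)
    (hv : ∀ j < k, d • coeff j (expSum r) • v = 0) :
    coeff k (expAd (-r) (PowerSeries.C d)) • v = d • coeff k (expSum r) • v := by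
  induction k using Nat.strong_induction_on with
  | _ k ih =>
  have h := congrArg (· • v) (congrArg (coeff k) (mul_expSum hr (PowerSeries.C d)))
  simp only [PowerSeries.coeff_C_mul, mul_smul] at h
  simp only [PowerSeries.coeff_mul, Finset.sum_smul, mul_smul] at h
  rw [h, Finset.sum_eq_single (0, k), coeff_zero_expSum, one_smul]
  · rintro ⟨i, j⟩ hij hne
    have hj : j < k := by
      rw [mem_antidiagonal] at hij
      grind
    rw [ih j hj fun j' hj' => hv j' (hj'.trans hj), hv j hj, smul_zero]
  · exact fun hn => absurd (mem_antidiagonal.2 (zero_add k)) hn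

end ExpSum

section DerivExpSum

open Finset.HasAntidiagonal (antidiagonal)
open PowerSeries (coeff)

theorem hasDerivAt_sum_pow_div_factorial {F : Type*} [NormedAddCommGroup F] [NormedSpace ℝ F]
    (K : ℕ) (x : ℕ → F) (s : ℝ) :
    HasDerivAt (fun s : ℝ => ∑ m ∈ Finset.range (K + 1), (s ^ m * (m.factorial : ℝ)⁻¹) • x m)
      (∑ m ∈ Finset.range K, (s ^ m * (m.factorial : ℝ)⁻¹) • x (m + 1)) s := by
  have h (m : ℕ) : HasDerivAt (fun s : ℝ => (s ^ (m + 1) * ((m + 1).factorial : ℝ)⁻¹) • x (m + 1))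
      ((s ^ m * (m.factorial : ℝ)⁻¹) • x (m + 1)) s := by
    refine HasDerivAt.smul_const ?_ _
    convert (hasDerivAt_pow (m + 1) s).mul_const ((m + 1).factorial : ℝ)⁻¹ using 1
    rw [Nat.factorial_succ]
    have : (m.factorial : ℝ) ≠ 0 := Nat.cast_ne_zero.2 m.factorial_ne_zero
    push_cast
    field_simp
  refine ((HasDerivAt.fun_sum fun m (_ : m ∈ Finset.range K) => h m).add_const
    ((s ^ 0 * ((0 : ℕ).factorial : ℝ)⁻¹) • x 0)).congr_of_eventuallyEq
      (Filter.Eventually.of_forall fun s => ?_)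
  simp only [Finset.sum_range_succ', pow_zero]

variable {R : Type*} [Ring R] [Algebra ℝ R] {F : Type*} [NormedAddCommGroup F]
  [NormedSpace ℝ F] {r : PowerSeries R}

theorem hasDerivAt_map_coeff_expSum (hr : r.constantCoeff = 0) (L : R →ₗ[ℝ] F) (k : ℕ) (s : ℝ) :
    HasDerivAt (fun s : ℝ => L (coeff k (expSum (s • r))))
      (L (coeff k (r * expSum (s • r)))) s := by
  rw [expSum, mul_adicSum _ (le_order_expSum_term (constantCoeff_real_smul hr s)), coeff_adicSum]
  simp only [coeff_expSum, smul_pow, mul_smul_comm, PowerSeries.coeff_smul, smul_smul,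
    ← pow_succ', mul_comm _⁻¹, map_sum, map_smul]
  rw [Finset.sum_range_succ, PowerSeries.coeff_of_lt_order k, map_zero, smul_zero, add_zero]
  · exact hasDerivAt_sum_pow_div_factorial k (fun m => L (coeff k (r ^ m))) s
  · exact lt_of_lt_of_le (by exact_mod_cast k.lt_succ_self)
      (PowerSeries.le_order_pow_of_constantCoeff_eq_zero (k + 1) hr)

theorem hasDerivAt_coeff_expSum_apply {V : Type*} [AddCommGroup V] [Module ℝ V]
    {r : PowerSeries (Module.End ℝ V)} (hr : r.constantCoeff = 0) (L : V →ₗ[ℝ] F) (v : V)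
    (k : ℕ) (s : ℝ) :
    HasDerivAt (fun s : ℝ => L (coeff k (expSum (s • r)) v))
      (∑ ij ∈ antidiagonal k, L (coeff ij.1 r (coeff ij.2 (expSum (s • r)) v))) s := by
  have h := hasDerivAt_map_coeff_expSum hr (L ∘ₗ LinearMap.applyₗ v) k s
  rw [PowerSeries.coeff_mul, map_sum] at h
  exact h

end DerivExpSum

section PiAntidiag

open Finset.HasAntidiagonal (antidiagonal mem_antidiagonal)

variable {ι : Type*} [Fintype ι] [DecidableEq ι]

theorem sum_update_add (c : ι → ℕ) (l : ι) (a : ℕ) :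
    Finset.univ.sum (Function.update c l a) + c l = Finset.univ.sum c + a := by
  rw [Finset.sum_update_of_mem (Finset.mem_univ l), ← Finset.add_sum_erase _ c (Finset.mem_univ l),
    Finset.sdiff_singleton_eq_erase]
  ring

theorem sum_piAntidiag_antidiagonal {M : Type*} [AddCommMonoid M] (k : ℕ) (l : ι)
    (f : (ι → ℕ) → ℕ → M) :
    ∑ c ∈ Finset.piAntidiag Finset.univ k, ∑ ab ∈ antidiagonal (c l),
      f (Function.update c l ab.1) ab.2 =
    ∑ ij ∈ antidiagonal k, ∑ c ∈ Finset.piAntidiag Finset.univ ij.2, f c ij.1 := by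
  rw [Finset.sum_sigma', Finset.sum_sigma']
  refine Finset.sum_bij'
    (fun q _ => ⟨(q.2.2, k - q.2.2), Function.update q.1 l q.2.1⟩)
    (fun q _ => ⟨Function.update q.2 l (q.2 l + q.1.1), (q.2 l, q.1.1)⟩) ?_ ?_ ?_ ?_ ?_
  · rintro ⟨c, a, b⟩ h
    simp only [Finset.mem_sigma, Finset.mem_piAntidiag, mem_antidiagonal, Finset.mem_univ,
      implies_true, and_true] at h ⊢
    have hupdate := sum_update_add c l a
    have := Finset.single_le_sum (f := c) (fun _ _ => Nat.zero_le _) (Finset.mem_univ l)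
    lia
  · rintro ⟨⟨i, j⟩, c⟩ h
    simp only [Finset.mem_sigma, Finset.mem_piAntidiag, mem_antidiagonal, Finset.mem_univ,
      implies_true, and_true, Function.update_self] at h ⊢
    have hupdate := sum_update_add c l (c l + i)
    lia
  · rintro ⟨c, a, b⟩ h
    simp only [Finset.mem_sigma, mem_antidiagonal] at h
    simp [h.2]
  · rintro ⟨⟨i, j⟩, c⟩ h
    simp only [Finset.mem_sigma, mem_antidiagonal] at h
    have : k - i = j := by lia
    simp [this]
  · exact fun _ _ => rfl

end PiAntidiag

section PullbackExp

open Finset.HasAntidiagonal (antidiagonal mem_antidiagonal)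
open PowerSeries (coeff)

variable {E : Type*} [NormedAddCommGroup E] [NormedSpace ℝ E] {p : ℕ}

theorem pullbackCoeff_update (g : ℕ → E →L[ℝ] E) (k : ℕ) (φ : E [⋀^Fin p]→L[ℝ] ℝ)
    (u : Fin p → E) (l : Fin p) (v : E) :
    pullbackCoeff g k φ (Function.update u l v) =
      ∑ c ∈ Finset.piAntidiag Finset.univ k,
        φ (Function.update (fun i => g (c i) (u i)) l (g (c l) v)) := by
  rw [pullbackCoeff_apply]
  refine Finset.sum_congr rfl fun c _ => congrArg φ (funext fun i => ?_)
  rcases eq_or_ne i l with rfl | h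
  · simp
  · simp [Function.update_of_ne h]

theorem sum_infAction_pullbackCoeff (g b : ℕ → E →L[ℝ] E) (k : ℕ) (φ : E [⋀^Fin p]→L[ℝ] ℝ)
    (u : Fin p → E) :
    ∑ ij ∈ antidiagonal k, infAction (b ij.1) (pullbackCoeff g ij.2 φ) u =
      ∑ c ∈ Finset.piAntidiag Finset.univ k, ∑ l, φ (Function.update (fun i => g (c i) (u i)) l
        (∑ ij ∈ antidiagonal (c l), g ij.1 (b ij.2 (u l)))) := by
  simp only [infAction_apply, pullbackCoeff_update]
  refine Finset.sum_comm.trans ((Finset.sum_congr rfl fun l _ => ?_).trans Finset.sum_comm)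
  rw [← sum_piAntidiag_antidiagonal k l fun c j => φ (Function.update
    (fun i => g (c i) (u i)) l (g (c l) (b j (u l))))]
  refine Finset.sum_congr rfl fun c _ => ?_
  refine Eq.symm <| (φ.toMultilinearMap.map_update_sum (antidiagonal (c l)) l
    (fun ij => g ij.1 (b ij.2 (u l))) fun i => g (c i) (u i)).trans ?_
  refine Finset.sum_congr rfl fun ij _ => congrArg φ (funext fun i => ?_)
  rcases eq_or_ne i l with rfl | h
  · simp
  · simp [Function.update_of_ne h]

theorem hasDerivAt_pullbackCoeff {g : ℝ → ℕ → E →L[ℝ] E} {b : ℕ → E →L[ℝ] E} {s : ℝ}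
    (hg : ∀ j, HasDerivAt (fun s => g s j) (∑ ij ∈ antidiagonal j, g s ij.1 * b ij.2) s)
    (k : ℕ) (φ : E [⋀^Fin p]→L[ℝ] ℝ) (u : Fin p → E) :
    HasDerivAt (fun s => pullbackCoeff (g s) k φ u)
      (∑ ij ∈ antidiagonal k, infAction (b ij.1) (pullbackCoeff (g s) ij.2 φ) u) s := by
  rw [sum_infAction_pullbackCoeff]
  simp only [pullbackCoeff_apply]
  refine HasDerivAt.fun_sum fun c _ => ?_
  have hgu (i : Fin p) : HasDerivAt (fun s => g s (c i) (u i))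
      (∑ ij ∈ antidiagonal (c i), g s ij.1 (b ij.2 (u i))) s :=
    ((hg (c i)).clm_apply (hasDerivAt_const s (u i))).congr_deriv (by simp)
  refine ((φ.toContinuousMultilinearMap.hasFDerivAt
    fun i => g s (c i) (u i)).comp_hasDerivAt s (hasDerivAt_pi.2 hgu)).congr_deriv ?_
  simp [ContinuousMultilinearMap.linearDeriv_apply]

theorem pullbackCoeff_coeff_one (k : ℕ) (φ : E [⋀^Fin p]→L[ℝ] ℝ) :
    pullbackCoeff (fun j => coeff j (1 : PowerSeries (E →L[ℝ] E))) k φ =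
      coeff k (1 : PowerSeries (Module.End ℝ (E [⋀^Fin p]→L[ℝ] ℝ))) φ := by
  ext u
  rw [pullbackCoeff_apply]
  rcases eq_or_ne k 0 with rfl | hk
  · simp [Finset.piAntidiag_zero]
  · rw [PowerSeries.coeff_one, if_neg hk]
    refine Finset.sum_eq_zero fun c hc => ?_
    rw [Finset.mem_piAntidiag] at hc
    obtain ⟨i, -, hi⟩ := Finset.exists_ne_zero_of_sum_ne_zero (hc.1.trans_ne hk)
    exact φ.map_coord_zero i (by simp [PowerSeries.coeff_one, hi])

variable (E p) in
/-- The representation `b ↦ ρ̂_b` of the endomorphisms of `E` on `p`-covectors. -/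
def infActionLin : (E →L[ℝ] E) →ₗ[ℝ] Module.End ℝ (E [⋀^Fin p]→L[ℝ] ℝ) :=
  LinearMap.mk₂ ℝ (fun b φ => infAction b φ) infAction_add_left infAction_smul_left infAction_add
    infAction_smul

variable (p) in
/-- The formal power series of operators `ρ̂_{B(t)}` on `p`-covectors. -/
def infActionSeries (B : PowerSeries (E →L[ℝ] E)) :
    PowerSeries (Module.End ℝ (E [⋀^Fin p]→L[ℝ] ℝ)) :=
  PowerSeries.mk fun k => infActionLin E p (coeff k B)

theorem coeff_infActionSeries_apply (B : PowerSeries (E →L[ℝ] E)) (k : ℕ)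
    (φ : E [⋀^Fin p]→L[ℝ] ℝ) : coeff k (infActionSeries p B) φ = infAction (coeff k B) φ := by
  rw [infActionSeries, PowerSeries.coeff_mk]
  rfl

theorem constantCoeff_infActionSeries {B : PowerSeries (E →L[ℝ] E)} (hB : B.constantCoeff = 0) :
    (infActionSeries p B).constantCoeff = 0 := by
  rw [← PowerSeries.coeff_zero_eq_constantCoeff_apply, infActionSeries, PowerSeries.coeff_mk,
    PowerSeries.coeff_zero_eq_constantCoeff_apply, hB, map_zero]

theorem hasDerivAt_pullbackCoeff_expSum {B : PowerSeries (E →L[ℝ] E)}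
    (hB : B.constantCoeff = 0) (k : ℕ) (φ : E [⋀^Fin p]→L[ℝ] ℝ) (u : Fin p → E) (s : ℝ) :
    HasDerivAt (fun s : ℝ => pullbackCoeff (fun j => coeff j (expSum (s • B))) k φ u)
      (∑ ij ∈ antidiagonal k, infAction (coeff ij.1 B)
        (pullbackCoeff (fun j => coeff j (expSum (s • B))) ij.2 φ) u) s := by
  refine hasDerivAt_pullbackCoeff (g := fun s j => coeff j (expSum (s • B)))
    (b := fun j => coeff j B) (fun j => ?_) k φ u
  have h := hasDerivAt_map_coeff_expSum (F := E →L[ℝ] E) hB LinearMap.id j s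
  rw [(commute_expSum_smul hB s).eq, PowerSeries.coeff_mul] at h
  exact h

theorem hasDerivAt_coeff_expSum_infActionSeries {B : PowerSeries (E →L[ℝ] E)}
    (hB : B.constantCoeff = 0) (k : ℕ) (φ : E [⋀^Fin p]→L[ℝ] ℝ) (u : Fin p → E) (s : ℝ) :
    HasDerivAt (fun s : ℝ => coeff k (expSum (s • infActionSeries p B)) φ u)
      (∑ ij ∈ antidiagonal k, infAction (coeff ij.1 B)
        (coeff ij.2 (expSum (s • infActionSeries p B)) φ) u) s := by
  refine (hasDerivAt_coeff_expSum_apply (constantCoeff_infActionSeries (p := p) hB)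
    (ContinuousAlternatingMap.apply ℝ E ℝ u).toLinearMap φ k s).congr_deriv ?_
  exact Finset.sum_congr rfl fun ij _ => congrArg (· u) (coeff_infActionSeries_apply _ _ _)

theorem pullbackCoeff_expSum_smul {B : PowerSeries (E →L[ℝ] E)} (hB : B.constantCoeff = 0)
    (k : ℕ) (φ : E [⋀^Fin p]→L[ℝ] ℝ) (s : ℝ) :
    pullbackCoeff (fun j => coeff j (expSum (s • B))) k φ =
      coeff k (expSum (s • infActionSeries p B)) φ := by
  induction k using Nat.strong_induction_on generalizing s with
  | _ k ih =>
  ext u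
  have hderiv (s : ℝ) := (hasDerivAt_pullbackCoeff_expSum hB k φ u s).sub
    (hasDerivAt_coeff_expSum_infActionSeries hB k φ u s)
  have hconst := is_const_of_deriv_eq_zero (fun s => (hderiv s).differentiableAt)
    (fun s => (hderiv s).deriv.trans ?_) s 0
  · simpa only [zero_smul, expSum_zero, pullbackCoeff_coeff_one, Pi.sub_apply, sub_self,
      sub_eq_zero] using hconst
  · rw [sub_eq_zero]
    refine Finset.sum_congr rfl fun ij hij => ?_
    rw [mem_antidiagonal] at hij
    rcases Nat.eq_zero_or_pos ij.1 with h | h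
    · rw [h, PowerSeries.coeff_zero_eq_constantCoeff_apply, hB, infAction_zero_left,
        infAction_zero_left]
    · rw [ih _ (by lia)]

theorem pullbackCoeff_expSum {B : PowerSeries (E →L[ℝ] E)} (hB : B.constantCoeff = 0)
    (k : ℕ) (φ : E [⋀^Fin p]→L[ℝ] ℝ) :
    pullbackCoeff (fun j => coeff j (expSum B)) k φ = coeff k (expSum (infActionSeries p B)) φ := by
  simpa only [one_smul] using pullbackCoeff_expSum_smul hB k φ 1

end PullbackExp

section FieldExp

open Finset.HasAntidiagonal (antidiagonal mem_antidiagonal)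
open PowerSeries (coeff)

variable {n : ℕ} {X : Type*} [TopologicalSpace X] [ChartedSpace (Model n) X]
  [IsManifold (𝓡 n) ∞ X] {p : ℕ}

/-- Evaluation of fields of endomorphisms at a point, as a ring homomorphism. -/
def EndField.valHom (x : X) : EndField n X →+* (Model n →L[ℝ] Model n) where
  toFun a := a.val x
  map_one' := rfl
  map_mul' _ _ := rfl
  map_zero' := rfl
  map_add' _ _ := rfl

theorem constantCoeff_map_valHom {A : PowerSeries (EndField n X)} (hA : A.constantCoeff = 0)
    (x : X) : (A.map (EndField.valHom x)).constantCoeff = 0 := by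
  rw [← PowerSeries.coeff_zero_eq_constantCoeff_apply, PowerSeries.coeff_map,
    PowerSeries.coeff_zero_eq_constantCoeff_apply, hA, map_zero]

theorem val_coeff_expSeries (A : PowerSeries (EndField n X)) (k : ℕ) (x : X) :
    EndField.val (coeff k (expSeries A)) x = coeff k (expSum (A.map (EndField.valHom x))) := by
  rw [expSeries, PowerSeries.coeff_mk, coeff_expSum]
  simp only [← map_pow, PowerSeries.coeff_map]
  exact map_sum (EndField.valHom x) _ _

theorem rhoHatPow_apply (A : PowerSeries (EndField n X)) (m k : ℕ) (η : FormField n X p) (x : X) :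
    rhoHatPow A m k η x = coeff k (infActionSeries p (A.map (EndField.valHom x)) ^ m) (η x) := by
  induction m generalizing k with
  | zero =>
    rw [pow_zero, PowerSeries.coeff_one]
    change (if k = 0 then η else 0) x = _
    split_ifs <;> rfl
  | succ m ih =>
    change (∑ ij ∈ antidiagonal k, rhoHat (coeff ij.1 A) (rhoHatPow A m ij.2 η)) x = _
    rw [Finset.sum_apply, pow_succ', PowerSeries.coeff_mul, LinearMap.sum_apply]
    refine Finset.sum_congr rfl fun ij _ => ?_
    rw [rhoHat, ih, Module.End.mul_apply, coeff_infActionSeries_apply, PowerSeries.coeff_map]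
    rfl

theorem rhoHatPow_eq_zero {A : PowerSeries (EndField n X)} (hA : A.constantCoeff = 0)
    (η : FormField n X p) {m k : ℕ} (hkm : k < m) : rhoHatPow A m k η = 0 := by
  funext x
  have horder := PowerSeries.le_order_pow_of_constantCoeff_eq_zero m
    (constantCoeff_infActionSeries (p := p) (constantCoeff_map_valHom hA x))
  rw [rhoHatPow_apply, PowerSeries.coeff_of_lt_order k ((Nat.cast_lt.2 hkm).trans_le horder)]
  rfl

theorem gaugeAction_expSeries {A : PowerSeries (EndField n X)} (hA : A.constantCoeff = 0)
    (k : ℕ) (η : FormField n X p) : gaugeAction (expSeries A) k η =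
      ∑ m ∈ Finset.range (k + 1), (m.factorial : ℝ)⁻¹ • rhoHatPow A m k η := by
  funext x
  simp only [gaugeAction, val_coeff_expSeries]
  rw [pullbackCoeff_expSum (constantCoeff_map_valHom hA x), Finset.sum_apply]
  refine (coeff_expSum_apply _ k (η x)).trans (Finset.sum_congr rfl fun m _ => ?_)
  rw [Pi.smul_apply, rhoHatPow_apply]

theorem IsSmoothForm.rhoHatPow {η : FormField n X p} (hη : IsSmoothForm η)
    (A : PowerSeries (EndField n X)) (m k : ℕ) : IsSmoothForm (rhoHatPow A m k η) := by
  induction m generalizing k with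
  | zero =>
    change IsSmoothForm (if k = 0 then η else 0)
    split_ifs
    exacts [hη, isSmoothForm_zero]
  | succ m ih => exact IsSmoothForm.sum fun ij _ => (ih ij.2).rhoHat _

end FieldExp

section Operators

variable {n : ℕ} {X : Type*} [TopologicalSpace X] [ChartedSpace (Model n) X] {p : ℕ}

variable (n X p) in
/-- The subspace of smooth `p`-forms. -/
def smoothForms : Submodule ℝ (FormField n X p) where
  carrier := {η | IsSmoothForm η}
  add_mem' := IsSmoothForm.add
  zero_mem' := isSmoothForm_zero
  smul_mem' c _ h := h.const_smul c

variable (n X p) in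
/-- The space of smooth `p`-forms, on which `d` is linear. It is a type of its own, so that
instance search does not have to unfold `FormField`. -/
def SmoothForm : Type _ := smoothForms n X p

instance : AddCommGroup (SmoothForm n X p) := inferInstanceAs (AddCommGroup (smoothForms n X p))

instance : Module ℝ (SmoothForm n X p) := inferInstanceAs (Module ℝ (smoothForms n X p))

/-- The inclusion of the smooth forms in all forms. -/
def SmoothForm.toField : SmoothForm n X p →ₗ[ℝ] FormField n X p := (smoothForms n X p).subtype

theorem SmoothForm.isSmoothForm (η : SmoothForm n X p) : IsSmoothForm η.toField := η.2

theorem SmoothForm.ext {η θ : SmoothForm n X p} (h : η.toField = θ.toField) : η = θ :=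
  Subtype.ext h

/-- A form which is smooth, as an element of `SmoothForm`. -/
def IsSmoothForm.toSmoothForm {η : FormField n X p} (hη : IsSmoothForm η) : SmoothForm n X p :=
  ⟨η, hη⟩

variable [IsManifold (𝓡 n) ∞ X]

theorem rhoHat_add (b : EndField n X) (η θ : FormField n X p) :
    rhoHat b (η + θ) = rhoHat b η + rhoHat b θ := funext fun _ => infAction_add _ _ _

theorem rhoHat_smul (b : EndField n X) (c : ℝ) (η : FormField n X p) :
    rhoHat b (c • η) = c • rhoHat b η := funext fun _ => infAction_smul _ _ _

theorem rhoHat_zero (b : EndField n X) : rhoHat b (0 : FormField n X p) = 0 :=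
  funext fun _ => infAction_zero _

theorem rhoHat_add_left (b b' : EndField n X) (η : FormField n X p) :
    rhoHat (b + b') η = rhoHat b η + rhoHat b' η := funext fun _ => infAction_add_left _ _ _

theorem rhoHat_smul_left (c : ℝ) (b : EndField n X) (η : FormField n X p) :
    rhoHat (c • b) η = c • rhoHat b η := funext fun _ => infAction_smul_left _ _ _

theorem rhoHat_zero_left (η : FormField n X p) : rhoHat (0 : EndField n X) η = 0 :=
  funext fun _ => infAction_zero_left _

theorem lieOp_add_left (b b' : EndField n X) {η : FormField n X p} (hη : IsSmoothForm η) :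
    lieOp (b + b') η = lieOp b η + lieOp b' η := by
  simp only [lieOp, rhoHat_add_left, extD_add (hη.rhoHat b) (hη.rhoHat b')]
  abel

theorem lieOp_zero_left (η : FormField n X p) : lieOp (0 : EndField n X) η = 0 := by
  rw [lieOp, rhoHat_zero_left, rhoHat_zero_left, extD_zero, sub_zero]

theorem lieOp_neg_left (b : EndField n X) {η : FormField n X p} (hη : IsSmoothForm η) :
    lieOp (-b) η = -lieOp b η := by
  rw [eq_neg_iff_add_eq_zero, ← lieOp_add_left _ _ hη, neg_add_cancel, lieOp_zero_left]

theorem lieOp_sum_left {ι : Type*} (s : Finset ι) (b : ι → EndField n X) {η : FormField n X p}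
    (hη : IsSmoothForm η) : lieOp (∑ i ∈ s, b i) η = ∑ i ∈ s, lieOp (b i) η := by
  classical
  induction s using Finset.induction_on with
  | empty => exact lieOp_zero_left η
  | insert i s hi ih => rw [Finset.sum_insert hi, Finset.sum_insert hi, lieOp_add_left _ _ hη, ih]

theorem lieOp_of_extD_eq_zero (b : EndField n X) {η : FormField n X p} (hη : extD η = 0) :
    lieOp b η = -extD (rhoHat b η) := by
  rw [lieOp, hη, rhoHat_zero, zero_sub]

/-- `ρ̂_b` as a linear operator on smooth forms. -/
def rhoHatLin (b : EndField n X) : SmoothForm n X p →ₗ[ℝ] SmoothForm n X p where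
  toFun η := (η.isSmoothForm.rhoHat b).toSmoothForm
  map_add' η θ := SmoothForm.ext (rhoHat_add b η.toField θ.toField)
  map_smul' c η := SmoothForm.ext (rhoHat_smul b c η.toField)

variable (n X p) in
/-- `d` as a linear operator on smooth forms. -/
def extDLin : SmoothForm n X p →ₗ[ℝ] SmoothForm n X (p + 1) where
  toFun η := η.isSmoothForm.extD.toSmoothForm
  map_add' η θ := SmoothForm.ext (extD_add η.isSmoothForm θ.isSmoothForm)
  map_smul' c η := SmoothForm.ext (extD_smul c η.toField)

end Operators

section OperatorSeries

open Finset.HasAntidiagonal (antidiagonal mem_antidiagonal)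
open PowerSeries (coeff)

variable {n : ℕ} {X : Type*} [TopologicalSpace X] [ChartedSpace (Model n) X] {p : ℕ}

variable (n X p) in
/-- The algebra of operators on pairs of smooth forms of degrees `p` and `p + 1`, which contains
both `d` and the operators `ρ̂_b`. -/
abbrev FormOp : Type _ := Module.End ℝ (SmoothForm n X p × SmoothForm n X (p + 1))

theorem toField_snd_coeff_expAd (r D : PowerSeries (FormOp n X p)) (k : ℕ)
    (q : SmoothForm n X p × SmoothForm n X (p + 1)) :
    (coeff k (expAd r D) q).2.toField = ∑ m ∈ Finset.range (k + 1),
      (m.factorial : ℝ)⁻¹ • (coeff k ((LieAlgebra.ad ℝ _ r ^ m) D) q).2.toField := by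
  rw [expAd, coeff_adicSum, LinearMap.sum_apply, Prod.snd_sum, map_sum SmoothForm.toField]
  refine Finset.sum_congr rfl fun m _ => ?_
  rw [PowerSeries.coeff_smul, LinearMap.smul_apply, Prod.smul_snd, map_smul SmoothForm.toField]

variable [IsManifold (𝓡 n) ∞ X]

/-- `ρ̂_b`, acting on forms of degree `p` and `p + 1`. -/
def rhoHatOp (b : EndField n X) : FormOp n X p := (rhoHatLin b).prodMap (rhoHatLin b)

variable (n X p) in
/-- `d`, acting on forms of degree `p` and `p + 1` as `(η, θ) ↦ (0, dη)`. -/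
def extDOp : FormOp n X p :=
  LinearMap.inr ℝ _ _ ∘ₗ extDLin n X p ∘ₗ LinearMap.fst ℝ _ _

variable (p) in
/-- `ρ̂_{A(t)}` as a power series of operators. -/
def rhoHatSeries (A : PowerSeries (EndField n X)) : PowerSeries (FormOp n X p) :=
  PowerSeries.mk fun k => rhoHatOp (coeff k A)

theorem constantCoeff_rhoHatSeries {A : PowerSeries (EndField n X)} (hA : A.constantCoeff = 0) :
    (rhoHatSeries p A).constantCoeff = 0 := by
  rw [← PowerSeries.coeff_zero_eq_constantCoeff_apply, rhoHatSeries, PowerSeries.coeff_mk,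
    PowerSeries.coeff_zero_eq_constantCoeff_apply, hA]
  exact LinearMap.ext fun _ =>
    Prod.ext (SmoothForm.ext (rhoHat_zero_left _)) (SmoothForm.ext (rhoHat_zero_left _))

theorem toField_fst_coeff_rhoHatSeries_pow (A : PowerSeries (EndField n X)) (m k : ℕ)
    (q : SmoothForm n X p × SmoothForm n X (p + 1)) :
    (coeff k (rhoHatSeries p A ^ m) q).1.toField = rhoHatPow A m k q.1.toField := by
  induction m generalizing k with
  | zero =>
    rw [pow_zero, PowerSeries.coeff_one]
    change _ = if k = 0 then q.1.toField else 0
    split_ifs <;> rfl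
  | succ m ih =>
    rw [pow_succ', PowerSeries.coeff_mul, LinearMap.sum_apply, Prod.fst_sum,
      map_sum SmoothForm.toField]
    refine Finset.sum_congr rfl fun ij _ => ?_
    rw [← ih, rhoHatSeries, PowerSeries.coeff_mk]
    rfl

theorem toField_fst_coeff_expSum_rhoHatSeries {A : PowerSeries (EndField n X)}
    (hA : A.constantCoeff = 0) (k : ℕ) (q : SmoothForm n X p × SmoothForm n X (p + 1)) :
    (coeff k (expSum (rhoHatSeries p A)) q).1.toField =
      gaugeAction (expSeries A) k q.1.toField := by
  rw [gaugeAction_expSeries hA, coeff_expSum_apply, Prod.fst_sum, map_sum SmoothForm.toField]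
  refine Finset.sum_congr rfl fun m _ => ?_
  rw [Prod.smul_fst, map_smul, toField_fst_coeff_rhoHatSeries_pow]

/-- The series of operators `Q` acts from degree `p` to degree `p + 1` as `P`. -/
def Represents (Q : PowerSeries (FormOp n X p)) (P : OpSeries n X p (p + 1)) : Prop :=
  ∀ k q, (coeff k Q q).2.toField = P k q.1.toField

theorem Represents.adRho {Q : PowerSeries (FormOp n X p)} {P : OpSeries n X p (p + 1)}
    (h : Represents Q P) (A : PowerSeries (EndField n X)) :
    Represents (LieAlgebra.ad ℝ _ (rhoHatSeries p A) Q) (adRho A P) := by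
  intro k q
  have hleft (ij : ℕ × ℕ) :
      ((coeff ij.1 (rhoHatSeries p A) * coeff ij.2 Q : FormOp n X p) q).2.toField =
        rhoHat (coeff ij.1 A) (P ij.2 q.1.toField) := by
    rw [← h, rhoHatSeries, PowerSeries.coeff_mk]
    rfl
  have hright (ij : ℕ × ℕ) :
      ((coeff ij.2 Q * coeff ij.1 (rhoHatSeries p A) : FormOp n X p) q).2.toField =
        P ij.2 (rhoHat (coeff ij.1 A) q.1.toField) := by
    rw [Module.End.mul_apply, h, rhoHatSeries, PowerSeries.coeff_mk]
    rfl
  rw [LieAlgebra.ad_apply, Ring.lie_def, map_sub, PowerSeries.coeff_mul, PowerSeries.coeff_mul,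
    ← Finset.Nat.sum_antidiagonal_swap (n := k)
      (f := fun ij => coeff ij.1 Q * coeff ij.2 (rhoHatSeries p A)),
    ← Finset.sum_sub_distrib, LinearMap.sum_apply, Prod.snd_sum, map_sum SmoothForm.toField]
  refine Finset.sum_congr rfl fun ij _ => ?_
  rw [← hleft, ← hright, ← map_sub]
  rfl

theorem represents_lieOp (A : PowerSeries (EndField n X)) :
    Represents (LieAlgebra.ad ℝ _ (rhoHatSeries p A) (PowerSeries.C (extDOp n X p)))
      (fun k => lieOp (coeff k A)) := by
  intro k q
  rw [LieAlgebra.ad_apply, Ring.lie_def, map_sub, PowerSeries.coeff_C_mul, PowerSeries.coeff_mul_C,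
    rhoHatSeries, PowerSeries.coeff_mk]
  rfl

theorem represents_GSeries (A : PowerSeries (EndField n X)) :
    Represents (-(LieAlgebra.ad ℝ _ (rhoHatSeries p A) ^ 2) (PowerSeries.C (extDOp n X p)))
      (GSeries A) := by
  intro k q
  have h := (represents_lieOp (p := p) A).adRho A k q
  rw [pow_two, Module.End.mul_apply, map_neg, LinearMap.neg_apply, Prod.snd_neg,
    map_neg SmoothForm.toField, h, GSeries, GaugeDef.adRho, neg_eq_iff_eq_neg, neg_sub,
    PowerSeries.coeff_mul, lieOp_sum_left _ _ q.1.isSmoothForm,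
    ← Finset.Nat.sum_antidiagonal_swap (n := k),
    ← Finset.Nat.sum_antidiagonal_swap (n := k) (f := fun ij => insertNijenhuis _ _ _),
    ← Finset.sum_sub_distrib]
  exact Finset.sum_congr rfl fun ij _ => rhoHat_lieOp_commutator _ _ q.1.isSmoothForm

theorem represents_iterate_adRho_GSeries (A : PowerSeries (EndField n X)) (m : ℕ) :
    Represents (-(LieAlgebra.ad ℝ _ (rhoHatSeries p A) ^ (m + 2)) (PowerSeries.C (extDOp n X p)))
      ((GaugeDef.adRho A)^[m] (GSeries A)) := by
  induction m with
  | zero => exact represents_GSeries A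
  | succ m ih =>
    rw [Function.iterate_succ_apply', Nat.add_right_comm, pow_succ', Module.End.mul_apply,
      ← map_neg]
    exact ih.adRho A

theorem toField_snd_coeff_ad_neg_pow (A : PowerSeries (EndField n X)) (m k : ℕ)
    (q : SmoothForm n X p × SmoothForm n X (p + 1)) :
    (coeff k ((LieAlgebra.ad ℝ _ (-rhoHatSeries p A) ^ (m + 2))
        (PowerSeries.C (extDOp n X p))) q).2.toField =
      (-1 : ℝ) ^ (m + 1) • ((GaugeDef.adRho A)^[m] (GSeries A)) k q.1.toField := by
  have h := represents_iterate_adRho_GSeries (p := p) A m k q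
  rw [map_neg, LinearMap.neg_apply, Prod.snd_neg, map_neg SmoothForm.toField] at h
  rw [← h, ad_neg_pow_apply, PowerSeries.coeff_smul, LinearMap.smul_apply, Prod.smul_snd,
    map_smul SmoothForm.toField, pow_succ _ (m + 1), mul_neg_one, neg_smul, smul_neg]

theorem rhoHatPow_zero {k : ℕ} (hk : k ≠ 0) (A : PowerSeries (EndField n X))
    (η : FormField n X p) : rhoHatPow A 0 k η = 0 :=
  if_neg hk

theorem rhoHatPow_one (A : PowerSeries (EndField n X)) (k : ℕ) (η : FormField n X p) :
    rhoHatPow A 1 k η = rhoHat (coeff k A) η := by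
  change ∑ ij ∈ antidiagonal k, rhoHat (coeff ij.1 A) (if ij.2 = 0 then η else 0) = _
  rw [Finset.sum_eq_single (k, 0)]
  · rfl
  · rintro ⟨i, j⟩ hij hne
    have hj : j ≠ 0 := by
      rw [mem_antidiagonal] at hij
      grind
    rw [if_neg hj, rhoHat_zero]
  · exact fun hn => absurd (mem_antidiagonal.2 (add_zero k)) hn

theorem sum_range_succ_eq_add_add_sum_Icc {M : Type*} [AddCommMonoid M] {k : ℕ} (hk : 1 ≤ k)
    (f : ℕ → M) : ∑ m ∈ Finset.range (k + 1), f m = f 0 + (f 1 + ∑ m ∈ Finset.Icc 2 k, f m) := by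
  rw [Finset.range_eq_Ico, Finset.sum_eq_sum_Ico_succ_bot (by lia),
    Finset.sum_eq_sum_Ico_succ_bot (by lia)]
  rfl

theorem extD_gaugeAction_expSeries {A : PowerSeries (EndField n X)} (hA : A.constantCoeff = 0)
    {η : FormField n X p} (hη : IsSmoothForm η) {k : ℕ} (hk : 1 ≤ k) :
    extD (gaugeAction (expSeries A) k η) =
      extD (rhoHat (coeff k A) η) + obstruction A k η := by
  rw [gaugeAction_expSeries hA, extD_sum fun m _ => (hη.rhoHatPow A m k).const_smul _]
  simp only [extD_smul]
  rw [sum_range_succ_eq_add_add_sum_Icc hk, rhoHatPow_one, rhoHatPow_zero (by lia), extD_zero,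
    smul_zero, zero_add, Nat.factorial_one, Nat.cast_one, inv_one, one_smul]
  rfl

theorem extD_gaugeAction_expSeries_zero {A : PowerSeries (EndField n X)}
    (hA : A.constantCoeff = 0) (η : FormField n X p) :
    extD (gaugeAction (expSeries A) 0 η) = extD η := by
  rw [gaugeAction_expSeries hA, Finset.sum_range_one, Nat.factorial_zero, Nat.cast_one, inv_one,
    one_smul]
  rfl

theorem toField_snd_coeff_expAd_neg_rhoHatSeries (A : PowerSeries (EndField n X)) {k : ℕ}
    (hk : 1 ≤ k) (q : SmoothForm n X p × SmoothForm n X (p + 1)) :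
    (coeff k (expAd (-rhoHatSeries p A) (PowerSeries.C (extDOp n X p))) q).2.toField =
      -lieOp (coeff k A) q.1.toField +
        ∑ m ∈ Finset.Icc 2 k, ((-1 : ℝ) ^ (m - 1) / (m.factorial : ℝ)) •
          ((GaugeDef.adRho A)^[m - 2] (GSeries A)) k q.1.toField := by
  rw [toField_snd_coeff_expAd, sum_range_succ_eq_add_add_sum_Icc hk]
  have hzero : (coeff k ((LieAlgebra.ad ℝ _ (-rhoHatSeries p A) ^ 0)
      (PowerSeries.C (extDOp n X p))) q).2.toField = 0 := by
    rw [pow_zero, Module.End.one_apply, PowerSeries.coeff_C, if_neg (by lia)]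
    rfl
  have hone : (coeff k ((LieAlgebra.ad ℝ _ (-rhoHatSeries p A) ^ 1)
      (PowerSeries.C (extDOp n X p))) q).2.toField = -lieOp (coeff k A) q.1.toField := by
    rw [pow_one, map_neg, LinearMap.neg_apply, map_neg, LinearMap.neg_apply, Prod.snd_neg,
      map_neg SmoothForm.toField]
    exact congrArg Neg.neg (represents_lieOp (p := p) A k q)
  rw [hzero, hone, smul_zero, zero_add, Nat.factorial_one, Nat.cast_one, inv_one, one_smul]
  congr 1
  refine Finset.sum_congr rfl fun m hm => ?_
  obtain ⟨l, rfl⟩ := Nat.exists_eq_add_of_le' (Finset.mem_Icc.1 hm).1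
  rw [toField_snd_coeff_ad_neg_pow, smul_smul, div_eq_inv_mul, Nat.add_sub_cancel]
  rfl

theorem obstruction_eq_sum {A : PowerSeries (EndField n X)} (hA : A.constantCoeff = 0)
    {η : FormField n X p} (hη : IsSmoothForm η) (hclosed : extD η = 0) {k : ℕ} (hk : 1 ≤ k)
    (hprev : ∀ j, 1 ≤ j → j < k → extD (gaugeAction (expSeries A) j η) = 0) :
    obstruction A k η = ∑ m ∈ Finset.Icc 2 k, ((-1 : ℝ) ^ (m - 1) / (m.factorial : ℝ)) •
        ((GaugeDef.adRho A)^[m - 2] (GSeries A)) k η := by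
  let v : SmoothForm n X p × SmoothForm n X (p + 1) := (hη.toSmoothForm, 0)
  have hextD (j : ℕ) : (extDOp n X p • coeff j (expSum (rhoHatSeries p A)) • v).2.toField =
      extD (gaugeAction (expSeries A) j η) :=
    congrArg extD (toField_fst_coeff_expSum_rhoHatSeries hA j v)
  have hvanish : ∀ j < k, extDOp n X p • coeff j (expSum (rhoHatSeries p A)) • v = 0 := by
    refine fun j hj => Prod.ext rfl (SmoothForm.ext ((hextD j).trans ?_))
    rcases Nat.eq_zero_or_pos j with rfl | hpos
    · rw [extD_gaugeAction_expSeries_zero hA, hclosed]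
      rfl
    · exact hprev j hpos hj
  have hconj := congrArg (fun q => q.2.toField)
    (coeff_expAd_neg_smul (constantCoeff_rhoHatSeries hA) (extDOp n X p) v k hvanish)
  rw [hextD, extD_gaugeAction_expSeries hA hη hk] at hconj
  have hsum := toField_snd_coeff_expAd_neg_rhoHatSeries A hk v
  rw [lieOp_of_extD_eq_zero _ (η := v.1.toField) hclosed, neg_neg] at hsum
  exact add_left_cancel (hconj.symm.trans hsum)

end OperatorSeries

section Truncation

open Finset.HasAntidiagonal (antidiagonal mem_antidiagonal)
open PowerSeries (coeff)

variable {n : ℕ} {X : Type*} [TopologicalSpace X] [ChartedSpace (Model n) X]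
  [IsManifold (𝓡 n) ∞ X] {p : ℕ} {A B : PowerSeries (EndField n X)} {k : ℕ}

theorem iterate_adRho_GSeries_eq_zero (hA : A.constantCoeff = 0) {η : FormField n X p}
    (hη : IsSmoothForm η) {m : ℕ} (hk : k < m + 2) : ((adRho A)^[m] (GSeries A)) k η = 0 := by
  have h := represents_iterate_adRho_GSeries (p := p) A m k (hη.toSmoothForm, 0)
  have horder := le_order_ad_pow (constantCoeff_rhoHatSeries (p := p) hA)
    (PowerSeries.C (extDOp n X p)) (m + 2)
  rw [map_neg, PowerSeries.coeff_of_lt_order k ((Nat.cast_lt.2 hk).trans_le horder), neg_zero] at h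
  exact h.symm

theorem fAdG_eq_sum (hA : A.constantCoeff = 0) {η : FormField n X p} (hη : IsSmoothForm η)
    (k : ℕ) : fAdG A k η = ∑ m ∈ Finset.Icc 2 k, ((-1 : ℝ) ^ (m - 1) / (m.factorial : ℝ)) •
      ((adRho A)^[m - 2] (GSeries A)) k η := by
  have hsupport : (Function.support fun m =>
      coeff m fSeries • ((adRho A)^[m] (GSeries A)) k η) ⊆ Finset.range (k + 1 - 2) := by
    intro m hm
    by_contra hlt
    rw [Finset.coe_range, Set.mem_Iio] at hlt
    exact hm (smul_eq_zero_of_right _ (iterate_adRho_GSeries_eq_zero hA hη (by lia)))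
  rw [fAdG, finsum_eq_sum_of_support_subset _ hsupport, ← Finset.Ico_add_one_right_eq_Icc,
    Finset.sum_Ico_eq_sum_range]
  refine Finset.sum_congr rfl fun m _ => ?_
  rw [fSeries, PowerSeries.coeff_mk, Nat.add_comm 2 m, Nat.add_sub_cancel]
  rfl

theorem obstruction_eq_fAdG (hA : A.constantCoeff = 0) {η : FormField n X p}
    (hη : IsSmoothForm η) (hclosed : extD η = 0) (hk : 1 ≤ k)
    (hprev : ∀ j, 1 ≤ j → j < k → extD (gaugeAction (expSeries A) j η) = 0) :
    obstruction A k η = fAdG A k η := by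
  rw [obstruction_eq_sum hA hη hclosed hk hprev, fAdG_eq_sum hA hη]

theorem rhoHatPow_congr (h : ∀ j < k, coeff j A = coeff j B) (η : FormField n X p) (m : ℕ) {j : ℕ}
    (hj : j < k) : rhoHatPow A m j η = rhoHatPow B m j η := by
  induction m generalizing j with
  | zero => rfl
  | succ m ih =>
    refine Finset.sum_congr rfl fun il hil => ?_
    rw [mem_antidiagonal] at hil
    rw [h _ (by lia), ih (by lia)]

theorem rhoHatPow_congr_of_two_le (hA : A.constantCoeff = 0) (hB : B.constantCoeff = 0)
    (h : ∀ j < k, coeff j A = coeff j B) (η : FormField n X p) {m : ℕ} (hm : 2 ≤ m) :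
    rhoHatPow A m k η = rhoHatPow B m k η := by
  obtain ⟨l, rfl⟩ := Nat.exists_eq_add_of_le' hm
  refine Finset.sum_congr rfl fun ij hij => ?_
  rw [mem_antidiagonal] at hij
  rcases Nat.eq_zero_or_pos ij.1 with hi | hi
  · rw [hi, PowerSeries.coeff_zero_eq_constantCoeff_apply,
      PowerSeries.coeff_zero_eq_constantCoeff_apply, hA, hB, rhoHat_zero_left, rhoHat_zero_left]
  rcases Nat.eq_zero_or_pos ij.2 with hj | hj
  · rw [hj, rhoHatPow_eq_zero hA _ l.succ_pos, rhoHatPow_eq_zero hB _ l.succ_pos, rhoHat_zero,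
      rhoHat_zero]
  · rw [h _ (by lia), rhoHatPow_congr h η _ (by lia)]

theorem obstruction_congr (hA : A.constantCoeff = 0) (hB : B.constantCoeff = 0)
    (h : ∀ j < k, coeff j A = coeff j B) (η : FormField n X p) :
    obstruction A k η = obstruction B k η :=
  Finset.sum_congr rfl fun m hm => by
    rw [rhoHatPow_congr_of_two_le hA hB h η (Finset.mem_Icc.1 hm).1]

theorem gaugeAction_expSeries_congr (hA : A.constantCoeff = 0) (hB : B.constantCoeff = 0)
    (h : ∀ j < k, coeff j A = coeff j B) (η : FormField n X p) {j : ℕ} (hj : j < k) :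
    gaugeAction (expSeries A) j η = gaugeAction (expSeries B) j η := by
  rw [gaugeAction_expSeries hA, gaugeAction_expSeries hB]
  exact Finset.sum_congr rfl fun m _ => by rw [rhoHatPow_congr h η m hj]

theorem constantCoeff_gaugeSeries (a : ℕ → EndField n X) : (gaugeSeries a).constantCoeff = 0 := by
  rw [← PowerSeries.coeff_zero_eq_constantCoeff_apply, gaugeSeries, PowerSeries.coeff_mk,
    if_pos rfl]

theorem constantCoeff_gaugeSeriesLT (a : ℕ → EndField n X) (k : ℕ) :
    (gaugeSeriesLT a k).constantCoeff = 0 :=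
  constantCoeff_gaugeSeries _

theorem coeff_gaugeSeries (a : ℕ → EndField n X) (hk : 1 ≤ k) :
    coeff k (gaugeSeries a) = (k.factorial : ℝ)⁻¹ • a k := by
  rw [gaugeSeries, PowerSeries.coeff_mk, if_neg (by lia)]

theorem coeff_gaugeSeriesLT (a : ℕ → EndField n X) {j : ℕ} (hj : j < k) :
    coeff j (gaugeSeriesLT a k) = coeff j (gaugeSeries a) := by
  rw [gaugeSeriesLT, gaugeSeries, gaugeSeries, PowerSeries.coeff_mk, PowerSeries.coeff_mk,
    if_pos hj]

theorem obstruction_gaugeSeriesLT (a : ℕ → EndField n X) (k : ℕ) (η : FormField n X p) :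
    obstruction (gaugeSeriesLT a k) k η = obstruction (gaugeSeries a) k η :=
  obstruction_congr (constantCoeff_gaugeSeriesLT a k) (constantCoeff_gaugeSeries a)
    (fun _ => coeff_gaugeSeriesLT a) η

theorem gaugeAction_expSeries_gaugeSeriesLT (a : ℕ → EndField n X) {j : ℕ} (hj : j < k)
    (η : FormField n X p) : gaugeAction (expSeries (gaugeSeriesLT a k)) j η =
      gaugeAction (expSeries (gaugeSeries a)) j η :=
  gaugeAction_expSeries_congr (constantCoeff_gaugeSeriesLT a k) (constantCoeff_gaugeSeries a)
    (fun _ => coeff_gaugeSeriesLT a) η hj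

theorem extD_gaugeAction_gaugeSeries (a : ℕ → EndField n X) {η : FormField n X p}
    (hη : IsSmoothForm η) (hk : 1 ≤ k) :
    extD (gaugeAction (expSeries (gaugeSeries a)) k η) =
      (k.factorial : ℝ)⁻¹ • extD (rhoHat (a k) η) + obstruction (gaugeSeriesLT a k) k η := by
  rw [extD_gaugeAction_expSeries (constantCoeff_gaugeSeries a) hη hk, obstruction_gaugeSeriesLT,
    coeff_gaugeSeries a hk, rhoHat_smul_left, extD_smul]

end Truncation

section SectionE2

open Finset.HasAntidiagonal (antidiagonal)
open PowerSeries (coeff)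

variable {n : ℕ} {X : Type*} [TopologicalSpace X] [ChartedSpace (Model n) X]
  [IsManifold (𝓡 n) ∞ X]

-- Instance search does not find this within its default limit.
instance : AddCommGroup (Model n →L[ℝ] Model n →L[ℝ] Model n) := ContinuousLinearMap.addCommGroup

theorem exists_GSeries_eq (A : PowerSeries (EndField n X)) (k : ℕ) (x : X) :
    ∃ M : Model n →L[ℝ] Model n →L[ℝ] Model n,
      ∀ {p : ℕ} {η : FormField n X p}, IsSmoothForm η →
        GSeries A k η x = wedgeAction (η x) M + lieOp (-coeff k (A * A)) η x := by
  refine ⟨∑ ij ∈ antidiagonal k, commutatorTensor ((coeff ij.1 A).val x) ((coeff ij.2 A).val x)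
    (chartEndDeriv (coeff ij.1 A) x) (chartEndDeriv (coeff ij.2 A) x), fun {p η} hη => ?_⟩
  rw [GSeries, lieOp_neg_left _ hη, wedgeAction_sum, Pi.sub_apply, Finset.sum_apply,
    Pi.neg_apply, sub_eq_add_neg]
  simp only [insertNijenhuis_apply]

theorem exists_infAction_wedgeAction_add_lieOp_commutator_eq (a b : EndField n X) (x : X)
    (M : Model n →L[ℝ] Model n →L[ℝ] Model n) :
    ∃ M' : Model n →L[ℝ] Model n →L[ℝ] Model n,
      ∀ {p : ℕ} {η : FormField n X p}, IsSmoothForm η →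
        infAction (a.val x) (wedgeAction (η x) M + lieOp b η x) -
            (wedgeAction (rhoHat a η x) M + lieOp b (rhoHat a η) x) =
          wedgeAction (η x) M' + lieOp (b * a) η x := by
  obtain ⟨N, hN⟩ : ∃ N : Model n →L[ℝ] Model n →L[ℝ] Model n,
      ∀ {p : ℕ} (φ : Model n [⋀^Fin p]→L[ℝ] ℝ),
        infAction (a.val x) (wedgeAction φ M) - wedgeAction (infAction (a.val x) φ) M =
          wedgeAction φ N :=
    ⟨_, infAction_wedgeAction_commutator (a.val x) M⟩
  refine ⟨N - commutatorTensor (a.val x) (b.val x) (chartEndDeriv a x) (chartEndDeriv b x),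
    fun {p η} hη => ?_⟩
  have hlie := congrFun (rhoHat_lieOp_commutator a b hη) x
  rw [Pi.sub_apply, Pi.sub_apply, insertNijenhuis_apply] at hlie
  rw [map_sub, ← hN, infAction_add, add_sub_add_comm]
  change _ + (rhoHat a (lieOp b η) x - _) = _
  rw [hlie]
  change _ - wedgeAction (rhoHat a η x) M + _ = _ - wedgeAction (rhoHat a η x) M - _ + _
  abel

theorem exists_iterate_adRho_GSeries_eq (A : PowerSeries (EndField n X)) (m k : ℕ) :
    ∃ (M : X → Model n →L[ℝ] Model n →L[ℝ] Model n) (b : EndField n X),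
      ∀ {p : ℕ} {η : FormField n X p}, IsSmoothForm η → ∀ x,
        ((adRho A)^[m] (GSeries A)) k η x = wedgeAction (η x) (M x) + lieOp b η x := by
  induction m generalizing k with
  | zero =>
    choose M hM using exists_GSeries_eq A k
    exact ⟨M, _, fun hη x => hM x hη⟩
  | succ m ih =>
    choose M b hMb using ih
    choose M' hM' using fun (ij : ℕ × ℕ) x =>
      exists_infAction_wedgeAction_add_lieOp_commutator_eq (coeff ij.1 A) (b ij.2) x (M ij.2 x)
    refine ⟨fun x => ∑ ij ∈ antidiagonal k, M' ij x,
      ∑ ij ∈ antidiagonal k, b ij.2 * coeff ij.1 A, fun {p η} hη x => ?_⟩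
    rw [Function.iterate_succ_apply', adRho, Finset.sum_apply, wedgeAction_sum,
      lieOp_sum_left _ _ hη, Finset.sum_apply, ← Finset.sum_add_distrib]
    refine Finset.sum_congr rfl fun ij _ => ?_
    rw [← hM' ij x hη, ← hMb _ hη, ← hMb _ (hη.rhoHat _)]
    rfl

theorem exists_isSmoothForm_obstruction_eq_extD {p : ℕ} {η : FormField n X p}
    (hη : IsSmoothForm η) (A : PowerSeries (EndField n X)) (k : ℕ) :
    ∃ β : FormField n X p, IsSmoothForm β ∧ obstruction A k η = extD β := by
  have hterm (m : ℕ) : IsSmoothForm ((m.factorial : ℝ)⁻¹ • rhoHatPow A m k η) :=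
    (hη.rhoHatPow A m k).const_smul _
  refine ⟨_, IsSmoothForm.sum (s := Finset.Icc 2 k) fun m _ => hterm m, ?_⟩
  simp only [obstruction, extD_sum fun m _ => hterm m, extD_smul]

theorem IsSmoothForm.obstruction {p : ℕ} {η : FormField n X p} (hη : IsSmoothForm η)
    (A : PowerSeries (EndField n X)) (k : ℕ) : IsSmoothForm (obstruction A k η) := by
  obtain ⟨β, hβ, hextD⟩ := exists_isSmoothForm_obstruction_eq_extD hη A k
  exact hextD ▸ hβ.extD

variable {V : Type*} [NormedAddCommGroup V] [NormedSpace ℝ V] {l : ℕ}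
  {p : Fin l → ℕ} {ΦV : ∀ i, V [⋀^Fin (p i)]→L[ℝ] ℝ} {Φ : ∀ i, FormField n X (p i)}

theorem IsOrbitSection.iterate_adRho_GSeries_mem_E2 (hΦ : IsOrbitSection ΦV Φ)
    (A : PowerSeries (EndField n X)) (m k : ℕ) (x : X) :
    (fun i => ((adRho A)^[m] (GSeries A)) k (Φ i) x) ∈ E2 fun i => Φ i x := by
  obtain ⟨M, b, hMb⟩ := exists_iterate_adRho_GSeries_eq A m k
  obtain ⟨M', hM'⟩ := hΦ.exists_lieOp_eq b x
  convert wedgeAction_mem_E2 (fun i => Φ i x) (M x + M') using 1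
  funext i
  rw [hMb (hΦ.1 i), hM', map_add]

theorem IsOrbitSection.isSectionE2_obstruction (hΦ : IsOrbitSection ΦV Φ)
    (hclosed : ∀ i, extD (Φ i) = 0) {A : PowerSeries (EndField n X)} (hA : A.constantCoeff = 0)
    {k : ℕ} (hk : 1 ≤ k)
    (hprev : ∀ j, 1 ≤ j → j < k → ∀ i, extD (gaugeAction (expSeries A) j (Φ i)) = 0) :
    IsSectionE2 Φ fun i => obstruction A k (Φ i) := by
  refine ⟨fun i => (hΦ.1 i).obstruction A k, fun x => ?_⟩
  have hsum : (fun i => obstruction A k (Φ i) x) =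
      ∑ m ∈ Finset.Icc 2 k, ((-1 : ℝ) ^ (m - 1) / (m.factorial : ℝ)) •
        fun i => ((adRho A)^[m - 2] (GSeries A)) k (Φ i) x := by
    funext i
    rw [obstruction_eq_sum hA (hΦ.1 i) (hclosed i) hk fun j hj hjk => hprev j hj hjk i,
      Finset.sum_apply, Finset.sum_apply]
    rfl
  rw [hsum]
  exact Submodule.sum_mem _ fun m _ =>
    Submodule.smul_mem _ _ (hΦ.iterate_adRho_GSeries_mem_E2 A _ k x)

end SectionE2

theorem hasSum_fSeries {x : ℝ} (hx : x ≠ 0) :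
    HasSum (fun m => PowerSeries.coeff m fSeries * x ^ m)
      (-(Real.exp (-x) - 1 + x) / x ^ 2) := by
  have htail : HasSum (fun m : ℕ => (-x) ^ (m + 2) / ((m + 2).factorial : ℝ))
      (Real.exp (-x) - ∑ i ∈ Finset.range 2, (-x) ^ i / (i.factorial : ℝ)) := by
    rw [hasSum_nat_add_iff' 2 (f := fun m => (-x) ^ m / (m.factorial : ℝ)), Real.exp_eq_exp_ℝ]
    exact NormedSpace.expSeries_div_hasSum_exp (-x)
  have hterm (m : ℕ) : (-x) ^ (m + 2) / ((m + 2).factorial : ℝ) * -(x ^ 2)⁻¹ =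
      PowerSeries.coeff m fSeries * x ^ m := by
    rw [fSeries, PowerSeries.coeff_mk, neg_pow x]
    field_simp
    ring
  have hlim : (Real.exp (-x) - ∑ i ∈ Finset.range 2, (-x) ^ i / (i.factorial : ℝ)) * -(x ^ 2)⁻¹ =
      -(Real.exp (-x) - 1 + x) / x ^ 2 := by
    simp only [Finset.sum_range_succ, Finset.sum_range_zero, pow_zero, pow_one,
      Nat.factorial_zero, Nat.factorial_one, Nat.cast_one]
    field_simp
    ring
  rw [← hlim, ← funext hterm]
  exact htail.mul_right _

end GaugeDef
end

theorem mainTheorem3_general {n : ℕ} {X : Type*} [TopologicalSpace X]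
    [ChartedSpace (EuclideanSpace ℝ (Fin n)) X] [IsManifold (𝓡 n) ∞ X]
    {V : Type*} [NormedAddCommGroup V] [NormedSpace ℝ V]
    {l : ℕ} {p : Fin l → ℕ} (ΦV : ∀ i, V [⋀^Fin (p i)]→L[ℝ] ℝ)
    (Φ : ∀ i, FormField n X (p i)) (hΦ : IsOrbitSection ΦV Φ) (hclosed : ∀ i, extD (Φ i) = 0)
    (a : ℕ → EndField n X) (k : ℕ) (hk : 1 ≤ k)
    (hprev : ∀ j, 1 ≤ j → j < k →
      ∀ i, extD (gaugeAction (expSeries (gaugeSeries a)) j (Φ i)) = 0) :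
    (∀ i, extD (gaugeAction (expSeries (gaugeSeries a)) k (Φ i)) =
      (k.factorial : ℝ)⁻¹ • extD (rhoHat (a k) (Φ i)) +
        obstruction (gaugeSeriesLT a k) k (Φ i)) ∧
    (∀ i, obstruction (gaugeSeriesLT a k) k (Φ i) =
      ∑ m ∈ Finset.Icc 2 k, ((-1 : ℝ) ^ (m - 1) / (m.factorial : ℝ)) •
        ((adRho (gaugeSeries a))^[m - 2] (GSeries (gaugeSeries a))) k (Φ i)) ∧
    (∀ i, obstruction (gaugeSeriesLT a k) k (Φ i) = fAdG (gaugeSeries a) k (Φ i)) ∧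
    (∀ i, obstruction (gaugeSeriesLT a k) k (Φ i) = fAdG (gaugeSeriesLT a k) k (Φ i)) ∧
    (∀ x : ℝ, x ≠ 0 → HasSum (fun m => PowerSeries.coeff m fSeries * x ^ m)
      (-(Real.exp (-x) - 1 + x) / x ^ 2)) ∧
    IsSectionE2 Φ (fun i => obstruction (gaugeSeriesLT a k) k (Φ i)) ∧
    (∃ β : ∀ i, FormField n X (p i), (∀ i, IsSmoothForm (β i)) ∧
      ∀ i, obstruction (gaugeSeriesLT a k) k (Φ i) = extD (β i)) := by
  have hprevLT (j : ℕ) (hj : 1 ≤ j) (hjk : j < k) (i : Fin l) :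
      extD (gaugeAction (expSeries (gaugeSeriesLT a k)) j (Φ i)) = 0 := by
    rw [gaugeAction_expSeries_gaugeSeriesLT a hjk, hprev j hj hjk i]
  have hcoeff := constantCoeff_gaugeSeries a
  have hcoeffLT := constantCoeff_gaugeSeriesLT a k
  choose β hβ hextD using fun i =>
    exists_isSmoothForm_obstruction_eq_extD (hΦ.1 i) (gaugeSeriesLT a k) k
  refine ⟨fun i => extD_gaugeAction_gaugeSeries a (hΦ.1 i) hk, fun i => ?_, fun i => ?_,
    fun i => obstruction_eq_fAdG hcoeffLT (hΦ.1 i) (hclosed i) hk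
      fun j hj hjk => hprevLT j hj hjk i,
    fun x hx => hasSum_fSeries hx, hΦ.isSectionE2_obstruction hclosed hcoeffLT hk hprevLT,
    β, hβ, hextD⟩
  · rw [obstruction_gaugeSeriesLT]
    exact obstruction_eq_sum hcoeff (hΦ.1 i) (hclosed i) hk fun j hj hjk => hprev j hj hjk i
  · rw [obstruction_gaugeSeriesLT]
    exact obstruction_eq_fAdG hcoeff (hΦ.1 i) (hclosed i) hk fun j hj hjk => hprev j hj hjk i

theorem mainTheorem3 {n : ℕ} {X : Type*} [TopologicalSpace X]
    [ChartedSpace (EuclideanSpace ℝ (Fin n)) X] [IsManifold (𝓡 n) ∞ X] [CompactSpace X] [T2Space X]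
    {V : Type*} [NormedAddCommGroup V] [NormedSpace ℝ V] [FiniteDimensional ℝ V]
    (_hV : Module.finrank ℝ V = n)
    {l : ℕ} {p : Fin l → ℕ} (ΦV : ∀ i, V [⋀^Fin (p i)]→L[ℝ] ℝ)
    (Φ : ∀ i, FormField n X (p i)) (hΦ : IsOrbitSection ΦV Φ) (hclosed : ∀ i, extD (Φ i) = 0)
    (a : ℕ → EndField n X) (k : ℕ) (hk : 1 ≤ k)
    (hprev : ∀ j, 1 ≤ j → j < k →
      ∀ i, extD (gaugeAction (expSeries (gaugeSeries a)) j (Φ i)) = 0) :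
    (∀ i, extD (gaugeAction (expSeries (gaugeSeries a)) k (Φ i)) =
      (k.factorial : ℝ)⁻¹ • extD (rhoHat (a k) (Φ i)) +
        obstruction (gaugeSeriesLT a k) k (Φ i)) ∧
    (∀ i, obstruction (gaugeSeriesLT a k) k (Φ i) =
      ∑ m ∈ Finset.Icc 2 k, ((-1 : ℝ) ^ (m - 1) / (m.factorial : ℝ)) •
        ((adRho (gaugeSeries a))^[m - 2] (GSeries (gaugeSeries a))) k (Φ i)) ∧
    (∀ i, obstruction (gaugeSeriesLT a k) k (Φ i) = fAdG (gaugeSeries a) k (Φ i)) ∧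
    (∀ i, obstruction (gaugeSeriesLT a k) k (Φ i) = fAdG (gaugeSeriesLT a k) k (Φ i)) ∧
    (∀ x : ℝ, x ≠ 0 → HasSum (fun m => PowerSeries.coeff m fSeries * x ^ m)
      (-(Real.exp (-x) - 1 + x) / x ^ 2)) ∧
    IsSectionE2 Φ (fun i => obstruction (gaugeSeriesLT a k) k (Φ i)) ∧
    (∃ β : ∀ i, FormField n X (p i), (∀ i, IsSmoothForm (β i)) ∧
      ∀ i, obstruction (gaugeSeriesLT a k) k (Φ i) = extD (β i)) :=
  mainTheorem3_general ΦV Φ hΦ hclosed a k hk hprev
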